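/- **Conventions.** A smooth potential on $\mathbb R^N$ is a continuous function $V:\mathbb R^N\to(-\infty,+\infty]$ that is $C^\infty$ on the open set $\{V<\infty\}$. Put $\Sigma_v=V^{-1}(v)$, let $d\sigma$ be the $(N-1)$-dimensional surface (normalised Hausdorff) measure, and let $\Omega(v,N)=\int_{\Sigma_v}\frac{d\sigma}{\|\nabla V\|}$ be the structure integral. Two subsets $A,B$ of Euclidean spaces are diffeomorphic ($A\approx B$) if there is a bijection $A\to B$ such that it and its inverse are locally restrictions of $C^\infty$ maps. A function is Morse on a set if each of its critical points in that set has nondegenerate Hessian. **(1) Fluid potentials.** Let $N=nd\ge 2$ and let $$V_N(q)=\sum_{i\ne j=1}^n\Psi(\|\vec q_i-\vec q_j\|)+\sum_{i=1}^nU_\Lambda(\vec q_i),\qquad \vec q_i\in\mathbb R^d,$$ be a smooth potential, where $\Psi$ is a function of one variable with values in $[-\infty,+\infty]$ and $U_\Lambda$ is a smooth potential on $\mathbb R^d$ which vanishes on a set $\Lambda'\subset\Lambda$ and equals $+\infty$ outside $\Lambda$, with $\Lambda\subset\mathbb R^d$ closed and bounded. Suppose that $V_N$ is Morse on $\{v_0\le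 V_N\le v_1\}$ and that $\Sigma_v\approx\Sigma_{v'}$ for all $v,v'\in[v_0,v_1]$. Then the integral $\Omega(v,N)$ converges for all $v\in(v_0,v_1)$, and $v\mapsto\Omega(v,N)$ is $C^\infty$ on $(v_0,v_1)$. **(2) Lattice potentials.** The same conclusion holds if $I\subset\mathbb N^d$ is a finite set of sites, $N=|I|D\ge2$, and $$V_N(q)=\sum_{i,j\in I}C_{ij}\Psi(\|\vec q_i-\vec q_j\|)+\sum_{i\in I}\Phi(\vec q_i),\qquad \vec q_i\in\mathbb R^D,\ C_{ij}\in\mathbb R,$$ is a smooth potential ($\Psi,\Phi$ with values in $[-\infty,+\infty]$, $0\cdot(\pm\infty)=0$ and $(+\infty)+(-\infty)=-\infty$) which is confining: for every $E\in\mathbb R$ there is a compact $K\subset\mathbb R^D$ such that $V_N(q)\le E$ implies $\vec q_i\in K$ for all $i$; again $V_N$ is assumed Morse on $\{v_0\le V_N\le v_1\}$ and $\Sigma_v\approx\Sigma_{v'}$ for all $v,v'\in[v_0,v_1]$. In particular, (1) and (2) apply to standard, smooth, confining, short-range, stable potentials which are Morse functions. **(3)** Let $N\ge2$, let $U\subset\mathbb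 R^N$ be open and bounded, let $\psi\in C^\infty(U)$ be real valued and Morse on $\{x\in U: v_0\le\psi(x)\le v_1\}$, and put $\Sigma_v=\{x\in U:\psi(x)=v\}$. If $\Sigma_v$ is compact for every $v\in[v_0,v_1]$ and $\Sigma_v\approx\Sigma_{v'}$ for all $v,v'\in[v_0,v_1]$, then for every $g\in C^\infty(U)$ the integral $\int_{\Sigma_v}g\,d\sigma$ converges for all $v\in(v_0,v_1)$ and is a $C^\infty$ function of $v$ on $(v_0,v_1)$. **(4)** Let $N\ge1$, let $U\subset\mathbb R^N$ be open and bounded, let $\psi\in C^\infty(U)$ be real valued, and put $\Sigma_v=\{x\in U:\psi(x)=v\}$. If $\{x\in U: a\le\psi(x)\le b\}$ is compact for all $a,b$ with $v_0<a$ and $b<v_1$, and if there is $C>0$ with $\|\nabla\psi(x)\|\ge C$ for all $x\in U$ with $v_0<\psi(x)<v_1$, then for every $g\in C^\infty(U)$ the integral $\int_{\Sigma_v}g\,d\sigma$ converges for all $v\in(v_0,v_1)$ and is a $C^\infty$ function of $v$ on $(v_0,v_1)$. -/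

import Mathlib

open MeasureTheory Set
open scoped ContDiff

namespace StructureIntegral

/-- A map between subsets of Euclidean spaces is smooth on an arbitrary subset `A` if near every
point of `A` it agrees on `A` with a `C^∞` map defined on an open set. -/
def SmoothOnSubset {E F : Type*} [NormedAddCommGroup E] [NormedSpace ℝ E]
    [NormedAddCommGroup F] [NormedSpace ℝ F] (f : E → F) (A : Set E) : Prop :=
  ∀ x ∈ A, ∃ (O : Set E) (g : E → F), IsOpen O ∧ x ∈ O ∧ ContDiffOn ℝ ∞ g O ∧ EqOn f g (A ∩ O)

/-- `C^∞`-diffeomorphic subsets of Euclidean spaces: there is a smooth bijection with smooth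
inverse.  (For embedded submanifolds this is the usual notion.) -/
def DiffeomorphicSubsets {E F : Type*} [NormedAddCommGroup E] [NormedSpace ℝ E]
    [NormedAddCommGroup F] [NormedSpace ℝ F] (A : Set E) (B : Set F) : Prop :=
  ∃ (f : E → F) (h : F → E), SmoothOnSubset f A ∧ SmoothOnSubset h B ∧
    MapsTo f A B ∧ MapsTo h B A ∧ LeftInvOn h f A ∧ RightInvOn h f B

/-- `f` is a Morse function on `S`: at each critical point of `f` lying in `S` the Hessian of `f`
is a nondegenerate bilinear form. -/
def MorseOn {E : Type*} [NormedAddCommGroup E] [NormedSpace ℝ E] (f : E → ℝ) (S : Set E) : Prop :=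
  ∀ x ∈ S, fderiv ℝ f x = 0 → ∀ u : E, (∀ w : E, fderiv ℝ (fderiv ℝ f) x u w = 0) → u = 0

/-- The surface element `dσ` of hypersurfaces of the Euclidean space `ℝ^κ`: the
`(N - 1)`-dimensional Hausdorff measure, `N` being the number of coordinates, normalised so as to
agree with Lebesgue measure on `(N - 1)`-dimensional Euclidean space. -/
noncomputable def surfaceMeasure (κ : Type*) [Fintype κ] : Measure (EuclideanSpace ℝ κ) :=
  Measure.euclideanHausdorffMeasure (Fintype.card κ - 1)

/-- A smooth potential with values in `(-∞, +∞]`: it never takes the value `-∞`, it is continuous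
as an extended-real-valued function (hence finite on an open set, and it tends to `+∞` when its
domain of finiteness is left), and it is `C^∞` where it is finite.  An everywhere finite potential
is smooth in this sense iff it is `C^∞`. -/
structure IsSmoothPotential {E : Type*} [NormedAddCommGroup E] [NormedSpace ℝ E]
    (V : E → EReal) : Prop where
  ne_bot : ∀ q, V q ≠ ⊥
  continuous : Continuous V
  contDiffOn : ContDiffOn ℝ ∞ (fun q => (V q).toReal) {q | V q ≠ ⊤}

/-- The equipotential set `Σ_v = V⁻¹(v)`. -/
def equipotential {E : Type*} (V : E → EReal) (v : ℝ) : Set E :=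
  {q | V q = (v : EReal)}

/-- The integrand `1 / ‖∇V‖` of the structure integral. -/
noncomputable def structureDensity {κ : Type*} [Fintype κ] (V : EuclideanSpace ℝ κ → EReal)
    (q : EuclideanSpace ℝ κ) : ℝ :=
  1 / ‖gradient (fun p => (V p).toReal) q‖

/-- The structure integral `Ω(v, N) = ∫_{Σ_v} dσ / ‖∇V‖`. -/
noncomputable def structureIntegral {κ : Type*} [Fintype κ] (V : EuclideanSpace ℝ κ → EReal)
    (v : ℝ) : ℝ :=
  ∫ q in equipotential V v, structureDensity V q ∂(surfaceMeasure κ)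

/-- The vector `q_i ∈ ℝ^D` of the degrees of freedom of the particle (or site) `i`, for a
configuration `q`. -/
def position {ι : Type*} {D : ℕ} (q : EuclideanSpace ℝ (ι × Fin D)) (i : ι) :
    EuclideanSpace ℝ (Fin D) :=
  WithLp.toLp 2 fun a => q (i, a)

/-- A smoothed potential barrier confining particles to the closed and bounded region `Λ`:
it vanishes on `Λ' ⊆ Λ`, equals `+∞` off `Λ`, and passes smoothly from `0` to `+∞` in between. -/
structure IsSmoothBarrier {d : ℕ} (Λ Λ' : Set (EuclideanSpace ℝ (Fin d)))
    (U : EuclideanSpace ℝ (Fin d) → EReal) : Prop where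
  isCompact : IsCompact Λ
  subset : Λ' ⊆ Λ
  eq_zero : ∀ x ∈ Λ', U x = 0
  eq_top : ∀ x ∈ Λᶜ, U x = ⊤
  smooth : IsSmoothPotential U

/-- The potential `∑_{i ≠ j} Ψ(‖q_i - q_j‖) + ∑_i U(q_i)` of a fluid of `n` particles in `ℝ^d`. -/
noncomputable def fluidPotential (n d : ℕ) (Ψ : ℝ → EReal) (U : EuclideanSpace ℝ (Fin d) → EReal)
    (q : EuclideanSpace ℝ (Fin n × Fin d)) : EReal :=
  (∑ p ∈ (Finset.univ : Finset (Fin n)).offDiag, Ψ ‖position q p.1 - position q p.2‖)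
    + ∑ i, U (position q i)

/-- The potential `∑_{i, j ∈ I} C_{ij} Ψ(‖q_i - q_j‖) + ∑_{i ∈ I} Φ(q_i)` of a system on the finite
set of lattice sites `I ⊆ ℕ^d`, with `D` degrees of freedom on each site. -/
noncomputable def latticePotential {d : ℕ} (I : Finset (Fin d → ℕ)) (D : ℕ)
    (C : (Fin d → ℕ) → (Fin d → ℕ) → ℝ) (Ψ : ℝ → EReal)
    (Φ : EuclideanSpace ℝ (Fin D) → EReal) (q : EuclideanSpace ℝ (I × Fin D)) : EReal :=
  (∑ i : I, ∑ j : I, (C i j : EReal) * Ψ ‖position q i - position q j‖)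
    + ∑ i : I, Φ (position q i)

/-- A confining lattice potential: at finite energy the vectors `q_i` are constrained to a compact
set of values. -/
def ConfinesSites {ι : Type*} {D : ℕ} (V : EuclideanSpace ℝ (ι × Fin D) → EReal) : Prop :=
  ∀ E : ℝ, ∃ K : Set (EuclideanSpace ℝ (Fin D)), IsCompact K ∧
    ∀ q, V q ≤ (E : EReal) → ∀ i, position q i ∈ K

/-- The structure integral of `V` is a convergent integral for every `v ∈ (v₀, v₁)` and a `C^∞`
function of `v` on that interval. -/
def SmoothStructureIntegral {κ : Type*} [Fintype κ] (V : EuclideanSpace ℝ κ → EReal)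
    (v₀ v₁ : ℝ) : Prop :=
  (∀ v ∈ Ioo v₀ v₁, IntegrableOn (structureDensity V) (equipotential V v) (surfaceMeasure κ)) ∧
    ContDiffOn ℝ ∞ (structureIntegral V) (Ioo v₀ v₁)

/-- The level set `{x ∈ U | ψ x = v}`. -/
def levelSet {E : Type*} (U : Set E) (ψ : E → ℝ) (v : ℝ) : Set E :=
  {x ∈ U | ψ x = v}

/-- For every `v ∈ (v₀, v₁)` the integral `∫_{Σ_v} g dσ` over the level set
`Σ_v = {x ∈ U | ψ x = v}` converges, and it is a `C^∞` function of `v` on that interval. -/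
def SmoothLevelIntegral {κ : Type*} [Fintype κ] (U : Set (EuclideanSpace ℝ κ))
    (ψ g : EuclideanSpace ℝ κ → ℝ) (v₀ v₁ : ℝ) : Prop :=
  (∀ v ∈ Ioo v₀ v₁, IntegrableOn g (levelSet U ψ v) (surfaceMeasure κ)) ∧
    ContDiffOn ℝ ∞ (fun v => ∫ x in levelSet U ψ v, g x ∂(surfaceMeasure κ)) (Ioo v₀ v₁)

end StructureIntegral

/-! Near a regular point, `ψ` together with the orthogonal projection to the kernel of its
derivative is a chart in which the level sets are slices. The area formula turns the integral over
a piece of a level set into a Lebesgue integral with a smooth parameter, so a partition of unity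
shows that the integral over a level set is smooth in the level as long as the nearby level sets
stay in a compact set of regular points.

A Morse function whose level sets are diffeomorphic has no critical point between the levels. Its
critical points are isolated, hence countable, so that some level is regular and all of them are
submanifolds. At a critical point the Hessian would then vanish on the tangent space of the level
set through it. But every null vector of the Hessian is tangent to that level set, and the null
cone of a nondegenerate form having a nonzero null vector is not a linear subspace.

Finally, a compact regular level set has a maximal number of disjoint clopen pieces. Each piece
persists in the nearby level sets, so a nearby level set that left a compact neighbourhood would
have one clopen piece more, and could not be diffeomorphic to the first. -/

namespace StructureIntegral

open Filter Topology Module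
open scoped NNReal ENNReal

section AreaFormula

theorem euclideanHausdorffMeasure_image_le_of_edist_le {α X Y : Type*}
    [EMetricSpace X] [MeasurableSpace X] [BorelSpace X]
    [EMetricSpace Y] [MeasurableSpace Y] [BorelSpace Y] {a : α → X} {b : α → Y} {A : Set α}
    {K : ℝ≥0} (h : ∀ y ∈ A, ∀ y' ∈ A, edist (a y) (a y') ≤ K * edist (b y) (b y')) (d : ℕ) :
    (μHE[d] : Measure X) (a '' A)
      ≤ (K : ℝ≥0∞) ^ d * (μHE[d] : Measure Y) (b '' A) := by
  rcases A.eq_empty_or_nonempty with rfl | ⟨y₀, -⟩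
  · simp
  have : Nonempty α := ⟨y₀⟩
  have hmem : ∀ y ∈ A, Function.invFunOn b A (b y) ∈ A ∧ b (Function.invFunOn b A (b y)) = b y :=
    fun y hy => ⟨Function.invFunOn_mem ⟨y, hy, rfl⟩, Function.invFunOn_eq ⟨y, hy, rfl⟩⟩
  have hlip : LipschitzOnWith K (a ∘ Function.invFunOn b A) (b '' A) := by
    rintro _ ⟨y, hy, rfl⟩ _ ⟨y', hy', rfl⟩
    have := h _ (hmem y hy).1 _ (hmem y' hy').1
    rwa [(hmem y hy).2, (hmem y' hy').2] at this
  have himage : (a ∘ Function.invFunOn b A) '' (b '' A) = a '' A := by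
    rw [image_image]
    refine image_congr fun y hy => ?_
    have := h _ (hmem y hy).1 _ hy
    rw [(hmem y hy).2, edist_self, mul_zero, nonpos_iff_eq_zero] at this
    exact edist_eq_zero.1 this
  have hle := hlip.hausdorffMeasure_image_le (d := d) (Nat.cast_nonneg _)
  rw [himage, ENNReal.rpow_natCast] at hle
  simp only [Measure.euclideanHausdorffMeasure_def, Measure.smul_apply]
  rw [mul_smul_comm]
  gcongr

theorem measure_le_mul_of_locally_le {X : Type*} [TopologicalSpace X] [SecondCountableTopology X]
    [MeasurableSpace X] [OpensMeasurableSpace X] {μ ν : Measure X} {c : ℝ≥0∞} {T A : Set X}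
    (h : ∀ x ∈ T, ∃ s ∈ 𝓝 x, ∀ A ⊆ s ∩ T, MeasurableSet A → μ A ≤ c * ν A)
    (hAT : A ⊆ T) (hA : MeasurableSet A) : μ A ≤ c * ν A := by
  choose! s hs hle using h
  obtain ⟨t, htT, htc, hcov⟩ := TopologicalSpace.countable_cover_nhdsWithin
    (s := T) (f := fun x => interior (s x))
    (fun x hx => mem_nhdsWithin_of_mem_nhds (interior_mem_nhds.2 (hs x hx)))
  rcases t.eq_empty_or_nonempty with rfl | hne
  · have : A = ∅ := subset_empty_iff.1 (hAT.trans (by simpa using hcov))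
    simp [this]
  obtain ⟨u, rfl⟩ := htc.exists_eq_range hne
  let B : ℕ → Set X := disjointed fun k => interior (s (u k))
  have hBm : ∀ k, MeasurableSet (A ∩ B k) := fun k =>
    hA.inter (MeasurableSet.disjointed (fun _ => isOpen_interior.measurableSet) k)
  have hBd : Pairwise (Function.onFun Disjoint fun k => A ∩ B k) := fun i j hij =>
    (disjoint_disjointed _ hij).mono inter_subset_right inter_subset_right
  have hAeq : A = ⋃ k, A ∩ B k := by
    rw [← inter_iUnion, iUnion_disjointed, eq_comm, inter_eq_left]
    exact hAT.trans (hcov.trans (by simp))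
  rw [hAeq, measure_iUnion hBd hBm, measure_iUnion hBd hBm, ← ENNReal.tsum_mul_left]
  exact ENNReal.tsum_le_tsum fun k => hle _ (htT (mem_range_self k)) _
    (fun x hx => ⟨interior_subset (disjointed_subset _ k hx.2), hAT hx.1⟩) (hBm k)

theorem measure_le_of_locally_le_mul {X : Type*} [TopologicalSpace X] [SecondCountableTopology X]
    [MeasurableSpace X] [OpensMeasurableSpace X] {μ ν : Measure X} {T : Set X}
    (hT : MeasurableSet T) (hμ : μ Tᶜ = 0)
    (h : ∀ C : ℝ≥0, 1 < C → ∀ x ∈ T, ∃ s ∈ 𝓝 x, ∀ A ⊆ s ∩ T, MeasurableSet A → μ A ≤ C * ν A) :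
    μ ≤ ν := by
  refine Measure.le_iff.2 fun A hA => ?_
  rw [← measure_inter_conull hμ]
  refine le_trans ?_ (measure_mono (inter_subset_left (t := T)))
  rcases eq_or_ne (ν (A ∩ T)) ⊤ with htop | htop
  · simp [htop]
  have hlim : Tendsto (fun C : ℝ≥0 => (C : ℝ≥0∞) * ν (A ∩ T)) (𝓝[>] 1) (𝓝 (1 * ν (A ∩ T))) :=
    ENNReal.Tendsto.mul_const
      ((ENNReal.tendsto_coe.2 tendsto_id).mono_left nhdsWithin_le_nhds) (Or.inr htop)
  rw [one_mul] at hlim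
  exact ge_of_tendsto hlim (eventually_mem_nhdsWithin.mono fun C hC =>
    measure_le_mul_of_locally_le (h C hC) inter_subset_right (hA.inter hT))

variable {H E : Type*} [NormedAddCommGroup H] [InnerProductSpace ℝ H] [FiniteDimensional ℝ H]
  [NormedAddCommGroup E] [InnerProductSpace ℝ E]

theorem exists_nhds_edist_le_mul_of_hasStrictFDerivAt {φ : H → E} {φ' : H →L[ℝ] E} {x : H}
    (hφ : HasStrictFDerivAt φ φ' x) (hinj : Function.Injective φ') {K : ℝ≥0} (hK : 1 < K) :
    ∃ s ∈ 𝓝 x, ∀ y ∈ s, ∀ y' ∈ s,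
      edist (φ y) (φ y') ≤ K * edist (φ' y) (φ' y') ∧
      edist (φ' y) (φ' y') ≤ K * edist (φ y) (φ y') := by
  obtain ⟨κ, hκ, hanti⟩ :=
    (φ' : H →ₗ[ℝ] E).exists_antilipschitzWith (LinearMap.ker_eq_bot.2 hinj)
  have hK' : (1 : ℝ) < K := by exact_mod_cast hK
  have hκ' : (0 : ℝ) < κ := by exact_mod_cast hκ
  obtain ⟨δ, hδ, hδκ⟩ : ∃ δ : ℝ, 0 < δ ∧ δ * κ = 1 - 1 / K := by
    refine ⟨(1 - 1 / K) / κ, div_pos (sub_pos.2 ?_) hκ', by field_simp⟩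
    rwa [div_lt_one (by positivity)]
  have hlin := (hasStrictFDerivAt_iff_isLittleO.1 hφ).def hδ
  rw [nhds_prod_eq] at hlin
  obtain ⟨s, hs, hle⟩ := mem_prod_self_iff.1 hlin
  refine ⟨s, hs, fun y hy y' hy' => ?_⟩
  have hanti' : ‖y - y'‖ ≤ κ * ‖φ' (y - y')‖ := by
    simpa [dist_eq_norm, map_sub] using hanti.le_mul_dist y y'
  have hsub : ‖φ y - φ y' - φ' (y - y')‖ ≤ (1 - 1 / K) * ‖φ' (y - y')‖ := by
    rw [← hδκ, mul_assoc]
    exact (hle (mk_mem_prod hy hy')).trans (mul_le_mul_of_nonneg_left hanti' hδ.le)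
  have hup : ‖φ y - φ y'‖ ≤ K * ‖φ' (y - y')‖ := by
    have htri := norm_add_le (φ y - φ y' - φ' (y - y')) (φ' (y - y'))
    rw [sub_add_cancel] at htri
    have hconst : 1 - 1 / (K : ℝ) + 1 ≤ K := by
      have : (K : ℝ) - (1 - 1 / K + 1) = (K - 1) ^ 2 / K := by field_simp; ring
      exact sub_nonneg.1 (this ▸ by positivity)
    nlinarith [mul_le_mul_of_nonneg_right hconst (norm_nonneg (φ' (y - y')))]
  have hdown : ‖φ' (y - y')‖ ≤ K * ‖φ y - φ y'‖ := by
    have htri := norm_sub_le (φ y - φ y') (φ y - φ y' - φ' (y - y'))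
    rw [sub_sub_cancel] at htri
    rw [← div_le_iff₀' (by positivity), div_eq_mul_one_div]
    linarith
  rw [edist_dist, edist_dist, dist_eq_norm, dist_eq_norm, ← map_sub,
    show (K : ℝ≥0∞) = ENNReal.ofReal K by simp, ← ENNReal.ofReal_mul (by positivity),
    ← ENNReal.ofReal_mul (by positivity)]
  exact ⟨ENNReal.ofReal_le_ofReal hup, ENNReal.ofReal_le_ofReal hdown⟩

theorem normDet_pos_of_injective {L : H →L[ℝ] E} (hL : Function.Injective L) :
    0 < (L : H →ₗ[ℝ] E).normDet := by
  refine (LinearMap.normDet_nonneg _).lt_of_ne' ?_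
  rw [Ne, LinearMap.normDet_eq_zero_iff_ker_ne_bot, not_not]
  exact LinearMap.ker_eq_bot.2 hL

variable [MeasurableSpace H] [BorelSpace H] [MeasurableSpace E] [BorelSpace E]

theorem exists_nhds_measure_image_le_mul_of_hasStrictFDerivAt {φ : H → E} {φ' : H →L[ℝ] E} {x : H}
    (hφ : HasStrictFDerivAt φ φ' x) (hinj : Function.Injective φ') {C : ℝ≥0} (hC : 1 < C) :
    ∃ s ∈ 𝓝 x, ∀ A ⊆ s,
      (μHE[finrank ℝ H] : Measure E) (φ '' A)
        ≤ C * (ENNReal.ofReal (φ' : H →ₗ[ℝ] E).normDet * volume A) ∧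
      ENNReal.ofReal (φ' : H →ₗ[ℝ] E).normDet * volume A
        ≤ C * (μHE[finrank ℝ H] : Measure E) (φ '' A) := by
  obtain ⟨K, hK, hKC⟩ : ∃ K : ℝ≥0, 1 < K ∧ (K : ℝ≥0∞) ^ finrank ℝ H ≤ C := by
    have hpow : Tendsto (fun K : ℝ≥0 => K ^ finrank ℝ H) (𝓝[>] 1) (𝓝 (1 ^ finrank ℝ H)) :=
      ((continuous_pow _).tendsto _).mono_left nhdsWithin_le_nhds
    rw [one_pow] at hpow
    obtain ⟨K, hKC, hK⟩ := ((hpow.eventually (gt_mem_nhds hC)).and self_mem_nhdsWithin).exists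
    exact ⟨K, hK, by exact_mod_cast hKC.le⟩
  obtain ⟨s, hs, hle⟩ := exists_nhds_edist_le_mul_of_hasStrictFDerivAt hφ hinj hK
  refine ⟨s, hs, fun A hA => ?_⟩
  rw [← (φ' : H →ₗ[ℝ] E).euclideanHausdorffMeasure_image_eq_normDet_mul_volume A]
  constructor
  · refine (euclideanHausdorffMeasure_image_le_of_edist_le (b := φ')
      (fun y hy y' hy' => (hle y (hA hy) y' (hA hy')).1) _).trans ?_
    gcongr
    rfl
  · refine (euclideanHausdorffMeasure_image_le_of_edist_le (a := φ') (b := φ)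
      (fun y hy y' hy' => (hle y (hA hy) y' (hA hy')).2) _).trans ?_
    gcongr

theorem exists_nhds_measure_image_le_mul_setLIntegral_normDet {φ : H → E} {φ' : H → H →L[ℝ] E}
    {x : H} (hφ : HasStrictFDerivAt φ (φ' x) x) (hinj : Function.Injective (φ' x))
    (hJ : ContinuousAt (fun y => (φ' y : H →ₗ[ℝ] E).normDet) x) {C : ℝ≥0} (hC : 1 < C) :
    ∃ s ∈ 𝓝 x, ∀ A ⊆ s, MeasurableSet A →
      (μHE[finrank ℝ H] : Measure E) (φ '' A)
        ≤ C * ∫⁻ y in A, ENNReal.ofReal (φ' y : H →ₗ[ℝ] E).normDet ∧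
      ∫⁻ y in A, ENNReal.ofReal (φ' y : H →ₗ[ℝ] E).normDet
        ≤ C * (μHE[finrank ℝ H] : Measure E) (φ '' A) := by
  set J : H → ℝ := fun y => (φ' y : H →ₗ[ℝ] E).normDet
  obtain ⟨B, hB, hBC⟩ : ∃ B : ℝ≥0, 1 < B ∧ (C : ℝ≥0∞) = B * B :=
    ⟨NNReal.sqrt C, by simpa using NNReal.sqrt_lt_sqrt.2 hC, by
      rw [← ENNReal.coe_mul, NNReal.mul_self_sqrt]⟩
  have hJx : 0 < J x := normDet_pos_of_injective hinj
  have hB' : (1 : ℝ) < B := by exact_mod_cast hB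
  have hlow : ∀ᶠ y in 𝓝 x, J x < B * J y :=
    (hJ.const_mul (B : ℝ)).eventually (lt_mem_nhds (lt_mul_of_one_lt_left hJx hB'))
  have hhigh : ∀ᶠ y in 𝓝 x, J y < B * J x :=
    hJ.eventually (gt_mem_nhds (lt_mul_of_one_lt_left hJx hB'))
  have hmul : ∀ a : ℝ, ENNReal.ofReal (B * a) = B * ENNReal.ofReal a := fun a => by
    rw [ENNReal.ofReal_mul B.coe_nonneg, ENNReal.ofReal_coe_nnreal]
  obtain ⟨s, hs, hle⟩ := exists_nhds_measure_image_le_mul_of_hasStrictFDerivAt hφ hinj hB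
  refine ⟨_, inter_mem hs (hlow.and hhigh), fun A hA hAm => ?_⟩
  obtain ⟨hle₁, hle₂⟩ := hle A fun y hy => (hA hy).1
  rw [hBC, mul_assoc, mul_assoc]
  refine ⟨hle₁.trans (mul_le_mul_right ?_ _), le_trans ?_ (mul_le_mul_right hle₂ _)⟩
  · rw [← setLIntegral_const, ← lintegral_const_mul' _ _ ENNReal.coe_ne_top]
    refine setLIntegral_mono' hAm fun y hy => ?_
    rw [← hmul]
    exact ENNReal.ofReal_le_ofReal (hA hy).2.1.le
  · rw [← setLIntegral_const, ← lintegral_const_mul' _ _ ENNReal.coe_ne_top]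
    refine setLIntegral_mono' hAm fun y hy => ?_
    rw [← hmul]
    exact ENNReal.ofReal_le_ofReal (hA hy).2.2.le

theorem map_restrict_euclideanHausdorffMeasure_image {φ : H → E} {φ' : H → H →L[ℝ] E} {π : E → H}
    {T : Set H} (hT : IsOpen T) (hπ : Continuous π) (hπφ : LeftInvOn π φ T)
    (hφ : ∀ y ∈ T, HasStrictFDerivAt φ (φ' y) y) (hinj : ∀ y ∈ T, Function.Injective (φ' y))
    (hJ : ContinuousOn (fun y => (φ' y : H →ₗ[ℝ] E).normDet) T) :
    (((μHE[finrank ℝ H] : Measure E).restrict (φ '' T)).map π) =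
      (volume.restrict T).withDensity
        (fun y => ENNReal.ofReal (φ' y : H →ₗ[ℝ] E).normDet) := by
  set σ := (μHE[finrank ℝ H] : Measure E)
  have hmap : ∀ A, MeasurableSet A → (σ.restrict (φ '' T)).map π A = σ (φ '' (A ∩ T)) := by
    intro A hA
    rw [Measure.map_apply hπ.measurable hA, Measure.restrict_apply (hπ.measurable hA),
      hπφ.image_inter']
  have hdens : ∀ A ⊆ T, MeasurableSet A → (volume.restrict T).withDensity
      (fun y => ENNReal.ofReal (φ' y : H →ₗ[ℝ] E).normDet) A =
        ∫⁻ y in A, ENNReal.ofReal (φ' y : H →ₗ[ℝ] E).normDet := by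
    intro A hAT hA
    rw [withDensity_apply _ hA, Measure.restrict_restrict hA, inter_eq_self_of_subset_left hAT]
  have hloc : ∀ x ∈ T, ∀ C : ℝ≥0, 1 < C → _ := fun x hx C hC =>
    exists_nhds_measure_image_le_mul_setLIntegral_normDet (hφ x hx) (hinj x hx)
      (hJ.continuousAt (hT.mem_nhds hx)) hC
  refine le_antisymm (measure_le_of_locally_le_mul hT.measurableSet ?_ fun C hC x hx => ?_)
    (measure_le_of_locally_le_mul hT.measurableSet ?_ fun C hC x hx => ?_)
  · rw [hmap _ hT.measurableSet.compl, compl_inter_self, image_empty, measure_empty]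
  · obtain ⟨s, hs, hle⟩ := hloc x hx C hC
    refine ⟨s, hs, fun A hA hAm => ?_⟩
    obtain ⟨hAs, hAT⟩ := subset_inter_iff.1 hA
    rw [hmap A hAm, inter_eq_self_of_subset_left hAT, hdens A hAT hAm]
    exact (hle A hAs hAm).1
  · rw [withDensity_apply _ hT.measurableSet.compl,
      Measure.restrict_restrict hT.measurableSet.compl]
    simp
  · obtain ⟨s, hs, hle⟩ := hloc x hx C hC
    refine ⟨s, hs, fun A hA hAm => ?_⟩
    obtain ⟨hAs, hAT⟩ := subset_inter_iff.1 hA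
    rw [hmap A hAm, inter_eq_self_of_subset_left hAT, hdens A hAT hAm]
    exact (hle A hAs hAm).2

theorem integrableOn_image_iff_and_setIntegral_image {φ : H → E} {φ' : H → H →L[ℝ] E} {π : E → H}
    {T : Set H} (hT : IsOpen T) (hπ : Continuous π) (hπφ : LeftInvOn π φ T)
    (hφ : ∀ y ∈ T, HasStrictFDerivAt φ (φ' y) y) (hinj : ∀ y ∈ T, Function.Injective (φ' y))
    (hJ : ContinuousOn (fun y => (φ' y : H →ₗ[ℝ] E).normDet) T) (hm : MeasurableSet (φ '' T))
    {g : E → ℝ} (hg : ContinuousOn g (φ '' T)) :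
    (IntegrableOn g (φ '' T) μHE[finrank ℝ H] ↔
      IntegrableOn (fun y => (φ' y : H →ₗ[ℝ] E).normDet * g (φ y)) T) ∧
    ∫ x in φ '' T, g x ∂μHE[finrank ℝ H] =
      ∫ y in T, (φ' y : H →ₗ[ℝ] E).normDet * g (φ y) := by
  set σ := (μHE[finrank ℝ H] : Measure E)
  let ρ : H → ℝ≥0 := fun y => (φ' y : H →ₗ[ℝ] E).normDet.toNNReal
  have hmap : (σ.restrict (φ '' T)).map π = (volume.restrict T).withDensity fun y => ρ y :=
    map_restrict_euclideanHausdorffMeasure_image hT hπ hπφ hφ hinj hJ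
  have hgφ : ContinuousOn (g ∘ φ) T :=
    hg.comp (fun y hy => (hφ y hy).continuousAt.continuousWithinAt) (mapsTo_image _ _)
  have hgπ : ∀ᵐ x ∂(σ.restrict (φ '' T)), ((g ∘ φ) ∘ π) x = g x := by
    refine (ae_restrict_iff' hm).2 (Eventually.of_forall ?_)
    rintro _ ⟨y, hy, rfl⟩
    simp [hπφ hy]
  have hae : AEStronglyMeasurable (g ∘ φ) ((σ.restrict (φ '' T)).map π) := by
    rw [hmap]
    exact (hgφ.aestronglyMeasurable hT.measurableSet).mono_ac (withDensity_absolutelyContinuous _ _)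
  have hρ : AEMeasurable ρ (volume.restrict T) := (hJ.aemeasurable hT.measurableSet).real_toNNReal
  have hsmul : ∀ y, ρ y • (g ∘ φ) y = (φ' y : H →ₗ[ℝ] E).normDet * g (φ y) := fun y => by
    rw [NNReal.smul_def, Real.coe_toNNReal _ (LinearMap.normDet_nonneg _), smul_eq_mul,
      Function.comp_apply]
  simp only [← hsmul, NNReal.smul_def]
  constructor
  · rw [IntegrableOn, IntegrableOn, ← integrable_congr hgπ,
      ← integrable_map_measure hae hπ.aemeasurable, hmap,
      integrable_withDensity_iff_integrable_coe_smul₀ hρ]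
  · rw [← integral_congr_ae hgπ]
    simp only [Function.comp_apply (f := g ∘ φ) (g := π)]
    rw [← integral_map hπ.aemeasurable hae, hmap, integral_withDensity_eq_integral_smul₀ hρ]
    simp only [NNReal.smul_def]

end AreaFormula

section LevelChart

theorem contDiffOn_normDet {E F H : Type*}
    [NormedAddCommGroup E] [InnerProductSpace ℝ E] [NormedAddCommGroup F] [NormedSpace ℝ F]
    [NormedAddCommGroup H] [InnerProductSpace ℝ H] [FiniteDimensional ℝ H] {L : F → H →L[ℝ] E}
    {s : Set F} {k : WithTop ℕ∞} (hL : ContDiffOn ℝ k L s)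
    (hinj : ∀ z ∈ s, Function.Injective (L z)) :
    ContDiffOn ℝ k (fun z => (L z : H →ₗ[ℝ] E).normDet) s := by
  classical
  let b := stdOrthonormalBasis ℝ H
  have hgram : ∀ z, (L z : H →ₗ[ℝ] E).normDet = √(Matrix.gram ℝ fun i => L z (b i)).det :=
    fun z => by
      have hsq : (L z : H →ₗ[ℝ] E).normDet ^ 2 = (Matrix.gram ℝ fun i => L z (b i)).det :=
        (L z : H →ₗ[ℝ] E).normDet_sq_eq_det_gram b
      rw [← hsq, Real.sqrt_sq (LinearMap.normDet_nonneg _)]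
  simp_rw [hgram]
  refine ContDiffOn.sqrt ?_ fun z hz h => ?_
  · simp only [Matrix.det_apply, Matrix.gram_apply]
    exact ContDiffOn.sum fun σ _ => ContDiffOn.const_smul _ <| contDiffOn_prod fun i _ =>
      (hL.clm_apply contDiffOn_const).inner ℝ (hL.clm_apply contDiffOn_const)
  · have hpos := normDet_pos_of_injective (hinj z hz)
    rw [hgram, h, Real.sqrt_zero] at hpos
    exact hpos.false

/-- The set of points of `U` at which `ψ` is regular. -/
def regularSet {E : Type*} [NormedAddCommGroup E] [NormedSpace ℝ E] (U : Set E) (ψ : E → ℝ) :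
    Set E :=
  {x ∈ U | fderiv ℝ ψ x ≠ 0}

theorem isOpen_regularSet {E : Type*} [NormedAddCommGroup E] [NormedSpace ℝ E] {U : Set E}
    {ψ : E → ℝ} (hU : IsOpen U) (hψ : ContDiffOn ℝ ∞ ψ U) : IsOpen (regularSet U ψ) :=
  (hψ.continuousOn_fderiv_of_isOpen hU (by simp)).isOpen_inter_preimage hU isOpen_ne

/-- The derivative, at the second coordinate of `z`, of the slice `y ↦ e.symm (z.1, y)` of the
inverse of a chart `e`. -/
noncomputable def sliceFDeriv {E F : Type*} [NormedAddCommGroup E] [NormedSpace ℝ E]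
    [NormedAddCommGroup F] [NormedSpace ℝ F] (e : OpenPartialHomeomorph E (ℝ × F)) (z : ℝ × F) :
    F →L[ℝ] E :=
  (fderiv ℝ e.symm z).comp (ContinuousLinearMap.inr ℝ ℝ F)

theorem isOpen_slice {X Y Z : Type*} [TopologicalSpace X] [TopologicalSpace Y] [TopologicalSpace Z]
    (e : OpenPartialHomeomorph X (Y × Z)) (v : Y) : IsOpen {y | (v, y) ∈ e.target} :=
  e.open_target.preimage (by fun_prop : Continuous fun y : Z => (v, y))

variable {E : Type*} [NormedAddCommGroup E] [InnerProductSpace ℝ E] [FiniteDimensional ℝ E]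

theorem exists_continuousLinearEquiv_eq_prod_orthogonalProjectionOnto {n : E} {l : E →L[ℝ] ℝ}
    (hl : l n ≠ 0) :
    ∃ A : E ≃L[ℝ] ℝ × (ℝ ∙ n)ᗮ, (A : E →L[ℝ] ℝ × (ℝ ∙ n)ᗮ) =
      l.prod (ℝ ∙ n)ᗮ.orthogonalProjectionOnto := by
  have hn : n ≠ 0 := fun h => hl (by simp [h])
  have hinj : Function.Injective
      ((l.prod (ℝ ∙ n)ᗮ.orthogonalProjectionOnto : E →L[ℝ] ℝ × (ℝ ∙ n)ᗮ) :
        E →ₗ[ℝ] ℝ × (ℝ ∙ n)ᗮ) := by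
    refine (injective_iff_map_eq_zero _).2 fun x hx => ?_
    have hproj : (ℝ ∙ n)ᗮ.orthogonalProjectionOnto x = 0 := congrArg Prod.snd hx
    rw [Submodule.orthogonalProjectionOnto_eq_zero_iff, Submodule.orthogonal_orthogonal,
      Submodule.mem_span_singleton] at hproj
    obtain ⟨c, rfl⟩ := hproj
    have hlx : l (c • n) = 0 := congrArg Prod.fst hx
    have : c = 0 := by simpa [hl] using hlx
    simp [this]
  have hdim : finrank ℝ E = finrank ℝ (ℝ × (ℝ ∙ n)ᗮ) := by
    rw [finrank_prod, finrank_self, ← finrank_span_singleton (K := ℝ) hn,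
      Submodule.finrank_add_finrank_orthogonal]
  exact ⟨(LinearEquiv.ofInjectiveOfFinrankEq _ hinj hdim).toContinuousLinearEquiv, rfl⟩

/-- A chart of `U` adapted to the level sets of `ψ`: its coordinates are the value of `ψ` and the
orthogonal projection to a hyperplane `H`, so that the inverse of the chart, with the first
coordinate fixed, parametrizes a level set as a graph over `H`. -/
structure IsLevelChart (U : Set E) (ψ : E → ℝ) (H : Submodule ℝ E)
    (e : OpenPartialHomeomorph E (ℝ × H)) : Prop where
  finrank_add_one : finrank ℝ H + 1 = finrank ℝ E
  source_subset : e.source ⊆ U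
  apply_eq : ∀ x, e x = (ψ x, H.orthogonalProjectionOnto x)
  contDiffOn_symm : ContDiffOn ℝ ∞ e.symm e.target

theorem exists_isLevelChart {U : Set E} {ψ : E → ℝ} (hU : IsOpen U) (hψ : ContDiffOn ℝ ∞ ψ U)
    {p : E} (hp : p ∈ regularSet U ψ) : ∃ H e, p ∈ e.source ∧ IsLevelChart U ψ H e := by
  obtain ⟨n, hn⟩ : ∃ n, fderiv ℝ ψ p n ≠ 0 := by
    by_contra! h
    exact hp.2 (ContinuousLinearMap.ext h)
  have hn0 : n ≠ 0 := fun h => hn (by simp [h])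
  let π := (ℝ ∙ n)ᗮ.orthogonalProjectionOnto
  let G : E → ℝ × (ℝ ∙ n)ᗮ := fun x => (ψ x, π x)
  have hψat : ∀ x ∈ U, ContDiffAt ℝ ∞ ψ x := fun x hx => hψ.contDiffAt (hU.mem_nhds hx)
  have hGat : ∀ x ∈ U, ContDiffAt ℝ ∞ G x := fun x hx =>
    (hψat x hx).prodMk π.contDiff.contDiffAt
  have hderiv : ∀ x ∈ U, fderiv ℝ ψ x n ≠ 0 →
      ∃ A : E ≃L[ℝ] ℝ × (ℝ ∙ n)ᗮ, HasFDerivAt G (A : E →L[ℝ] ℝ × (ℝ ∙ n)ᗮ) x := by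
    intro x hx hxn
    obtain ⟨A, hA⟩ := exists_continuousLinearEquiv_eq_prod_orthogonalProjectionOnto hxn
    refine ⟨A, ?_⟩
    rw [hA]
    exact ((hψat x hx).differentiableAt (by simp)).hasFDerivAt.prodMk π.hasFDerivAt
  have hO : IsOpen {x ∈ U | fderiv ℝ ψ x n ≠ 0} :=
    ((hψ.continuousOn_fderiv_of_isOpen hU (by simp)).clm_apply
      continuousOn_const).isOpen_inter_preimage hU isOpen_ne
  obtain ⟨A, hA⟩ := hderiv p hp.1 hn
  let e := ((hGat p hp.1).toOpenPartialHomeomorph G hA (by simp)).restrOpen _ hO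
  refine ⟨(ℝ ∙ n)ᗮ, e, ⟨(hGat p hp.1).mem_toOpenPartialHomeomorph_source hA (by simp), hp.1, hn⟩,
    ?_, fun x hx => hx.2.1, fun x => rfl, fun z hz => ?_⟩
  · rw [← Submodule.finrank_add_finrank_orthogonal (ℝ ∙ n), finrank_span_singleton hn0, add_comm]
  · have hez := (e.map_target hz).2
    obtain ⟨B, hB⟩ := hderiv _ hez.1 hez.2
    exact (e.contDiffAt_symm hz hB (hGat _ hez.1)).contDiffWithinAt

namespace IsLevelChart

variable {U : Set E} {ψ : E → ℝ} {H : Submodule ℝ E} {e : OpenPartialHomeomorph E (ℝ × H)}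

theorem apply_symm (he : IsLevelChart U ψ H e) {z : ℝ × H} (hz : z ∈ e.target) :
    ψ (e.symm z) = z.1 ∧ H.orthogonalProjectionOnto (e.symm z) = z.2 :=
  Prod.ext_iff.1 ((he.apply_eq (e.symm z)).symm.trans (e.right_inv hz))

theorem symm_eq (he : IsLevelChart U ψ H e) {x : E} (hx : x ∈ e.source) :
    (ψ x, H.orthogonalProjectionOnto x) ∈ e.target ∧
      e.symm (ψ x, H.orthogonalProjectionOnto x) = x := by
  rw [← he.apply_eq]
  exact ⟨e.map_source hx, e.left_inv hx⟩

theorem image_slice (he : IsLevelChart U ψ H e) (v : ℝ) :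
    (fun y => e.symm (v, y)) '' {y | (v, y) ∈ e.target} = levelSet U ψ v ∩ e.source := by
  ext x
  constructor
  · rintro ⟨y, hy, rfl⟩
    exact ⟨⟨he.source_subset (e.map_target hy), (he.apply_symm hy).1⟩, e.map_target hy⟩
  · rintro ⟨⟨-, rfl⟩, hxe⟩
    exact ⟨H.orthogonalProjectionOnto x, he.symm_eq hxe⟩

theorem contDiffAt_symm (he : IsLevelChart U ψ H e) {z : ℝ × H} (hz : z ∈ e.target) :
    ContDiffAt ℝ ∞ e.symm z :=
  he.contDiffOn_symm.contDiffAt (e.open_target.mem_nhds hz)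

theorem hasStrictFDerivAt_slice (he : IsLevelChart U ψ H e) {v : ℝ} {y : H}
    (hy : (v, y) ∈ e.target) :
    HasStrictFDerivAt (fun y => e.symm (v, y)) (sliceFDeriv e (v, y)) y :=
  ((he.contDiffAt_symm hy).hasStrictFDerivAt (by simp)).comp y
    ((hasStrictFDerivAt_const v y).prodMk (hasStrictFDerivAt_id y))

theorem injective_sliceFDeriv (he : IsLevelChart U ψ H e) {z : ℝ × H} (hz : z ∈ e.target) :
    Function.Injective (sliceFDeriv e z) := by
  obtain ⟨v, y⟩ := z
  have hcomp : HasFDerivAt (fun y => H.orthogonalProjectionOnto (e.symm (v, y)))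
      (H.orthogonalProjectionOnto.comp (sliceFDeriv e (v, y))) y :=
    H.orthogonalProjectionOnto.hasFDerivAt.comp y (he.hasStrictFDerivAt_slice hz).hasFDerivAt
  have hid : (fun y => H.orthogonalProjectionOnto (e.symm (v, y))) =ᶠ[𝓝 y] id := by
    filter_upwards [(isOpen_slice e v).mem_nhds hz] with y' hy'
    exact (he.apply_symm hy').2
  have heq := hcomp.unique ((hasFDerivAt_id y).congr_of_eventuallyEq hid)
  exact Function.LeftInverse.injective (g := H.orthogonalProjectionOnto) (DFunLike.congr_fun heq)

theorem contDiffOn_normDet_sliceFDeriv (he : IsLevelChart U ψ H e) :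
    ContDiffOn ℝ ∞ (fun z => (sliceFDeriv e z : H →ₗ[ℝ] E).normDet) e.target :=
  contDiffOn_normDet
    ((he.contDiffOn_symm.fderiv_of_isOpen e.open_target (by simp)).clm_comp contDiffOn_const)
    fun _ => he.injective_sliceFDeriv

end IsLevelChart

end LevelChart

section SmoothExtension

theorem contDiff_of_contDiffOn_of_eq_zero {E F : Type*} [NormedAddCommGroup E] [NormedSpace ℝ E]
    [NormedAddCommGroup F] [NormedSpace ℝ F] {k : WithTop ℕ∞} {f : E → F} {K O : Set E}
    (hK : IsClosed K) (hO : IsOpen O) (hKO : K ⊆ O) (hf : ContDiffOn ℝ k f O)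
    (h0 : ∀ x ∉ K, f x = 0) : ContDiff ℝ k f := by
  refine contDiff_iff_contDiffAt.2 fun x => ?_
  by_cases hx : x ∈ O
  · exact hf.contDiffAt (hO.mem_nhds hx)
  · exact (contDiffAt_const (c := (0 : F))).congr_of_eventuallyEq
      (eventually_of_mem (hK.isOpen_compl.mem_nhds fun hxK => hx (hKO hxK)) h0)

variable {E : Type*} [NormedAddCommGroup E] [NormedSpace ℝ E] [FiniteDimensional ℝ E]

open scoped Manifold in
theorem exists_finset_contDiff_sum_eq {ι : Type*} {g : E → ℝ}
    (hg : ContDiff ℝ ∞ g) (hgc : HasCompactSupport g) {W : ι → Set E} (hW : ∀ i, IsOpen (W i))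
    (hcov : tsupport g ⊆ ⋃ i, W i) :
    ∃ (t : Finset ι) (h : ι → E → ℝ), (∀ i, ContDiff ℝ ∞ (h i) ∧ HasCompactSupport (h i) ∧
      tsupport (h i) ⊆ W i) ∧ g = fun x => ∑ i ∈ t, h i x := by
  obtain ⟨f, hf⟩ := SmoothPartitionOfUnity.exists_isSubordinate 𝓘(ℝ, E)
    (isClosed_tsupport g) W hW hcov
  have hfin := f.locallyFinite.finite_nonempty_inter_compact hgc.isCompact
  refine ⟨hfin.toFinset, fun i x => f i x * g x, fun i => ⟨?_, hgc.mul_left, ?_⟩, ?_⟩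
  · exact (contMDiff_iff_contDiff.1 (f i).contMDiff).mul hg
  · exact (tsupport_mul_subset_left (f := f i) (g := g)).trans (hf i)
  · funext x
    rw [← Finset.sum_mul]
    by_cases hx : x ∈ tsupport g
    · have hsum := f.sum_eq_one hx
      rw [finsum_eq_sum_of_support_subset (s := hfin.toFinset)] at hsum
      · rw [hsum, one_mul]
      · exact fun i hi => hfin.coe_toFinset.symm ▸ ⟨x, hi, hx⟩
    · rw [image_eq_zero_of_notMem_tsupport hx, mul_zero]

theorem exists_contDiff_eqOn_of_isCompact {R Q : Set E} (hR : IsOpen R) (hQ : IsCompact Q)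
    (hQR : Q ⊆ R) {g : E → ℝ} (hg : ContDiffOn ℝ ∞ g R) :
    ∃ g' : E → ℝ, ContDiff ℝ ∞ g' ∧ HasCompactSupport g' ∧ tsupport g' ⊆ R ∧ EqOn g' g Q := by
  obtain ⟨t, ht, hQt, htR⟩ := exists_compact_between hQ hR hQR
  obtain ⟨η, h1, h0, -⟩ := exists_contMDiffMap_one_nhds_of_subset_interior
    (modelWithCornersSelf ℝ E) (n := ⊤) hQ.isClosed hQt
  have hη : ContDiff ℝ ∞ η := contMDiff_iff_contDiff.1 η.contMDiff
  have hzero : ∀ x ∉ t, η x * g x = 0 := fun x hx => by rw [h0 x hx, zero_mul]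
  refine ⟨fun x => η x * g x,
    contDiff_of_contDiffOn_of_eq_zero ht.isClosed hR htR (hη.contDiffOn.mul hg) hzero,
    HasCompactSupport.intro ht hzero, ?_, fun x hx => ?_⟩
  · exact (closure_minimal (Function.support_subset_iff'.2 hzero) ht.isClosed).trans htR
  · change η x * g x = g x
    rw [h1.self_of_nhdsSet x hx, one_mul]

end SmoothExtension

section LevelIntegral

theorem contDiff_integral_of_hasCompactSupport {P H : Type*} [NormedAddCommGroup P]
    [NormedSpace ℝ P] [NormedAddCommGroup H] [NormedSpace ℝ H] [MeasurableSpace H] [BorelSpace H]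
    {μ : Measure H} [IsLocallyFiniteMeasure μ] {k : P × H → ℝ} (hk : ContDiff ℝ ∞ k)
    (hc : HasCompactSupport k) : ContDiff ℝ ∞ fun v => ∫ y, k (v, y) ∂μ := by
  -- The integral is the value at `0` of the convolution of `1` with `y ↦ k (v, -y)`.
  let K : Set H := (fun z : P × H => -z.2) '' tsupport k
  have hK : IsCompact K := hc.isCompact.image (by fun_prop)
  have hflip : ContDiff ℝ ∞ fun q : P × H => (q.1, -q.2) := by fun_prop
  have hconv := contDiffOn_convolution_right_with_param (𝕜 := ℝ) (μ := μ) (n := ⊤)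
    (f := fun _ : H => (1 : ℝ)) (ContinuousLinearMap.mul ℝ ℝ) (g := fun v y => k (v, -y))
    (s := univ) isOpen_univ hK
    (fun v x _ hx => by_contra fun hne => hx ⟨(v, -x), subset_tsupport _ hne, by simp⟩)
    (locallyIntegrable_const _) (hk.comp hflip).contDiffOn
  rw [univ_prod_univ, contDiffOn_univ] at hconv
  simpa [Function.comp_def, convolution] using
    hconv.comp (by fun_prop : ContDiff ℝ ∞ fun v : P => (v, (0 : H)))

theorem measurableSet_levelSet {E : Type*} [TopologicalSpace E] [MeasurableSpace E]
    [OpensMeasurableSpace E] {U : Set E} {ψ : E → ℝ} (hU : IsOpen U)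
    (hψ : ContinuousOn ψ U) (v : ℝ) : MeasurableSet (levelSet U ψ v) := by
  have hdiff : levelSet U ψ v = U \ (U ∩ ψ ⁻¹' {v}ᶜ) := by
    ext x
    simp +contextual [levelSet]
  rw [hdiff]
  exact hU.measurableSet.diff (hψ.isOpen_inter_preimage hU isOpen_compl_singleton).measurableSet

variable {E : Type*} [NormedAddCommGroup E] [InnerProductSpace ℝ E] [FiniteDimensional ℝ E]

namespace IsLevelChart

variable {U : Set E} {ψ : E → ℝ} {H : Submodule ℝ E} {e : OpenPartialHomeomorph E (ℝ × H)}

theorem contDiff_and_hasCompactSupport_indicator (he : IsLevelChart U ψ H e) {g : E → ℝ}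
    (hg : ContDiff ℝ ∞ g) (hgc : HasCompactSupport g) (hge : tsupport g ⊆ e.source) :
    ContDiff ℝ ∞ (e.target.indicator fun z =>
        (sliceFDeriv e z : H →ₗ[ℝ] E).normDet * g (e.symm z)) ∧
      HasCompactSupport (e.target.indicator fun z =>
        (sliceFDeriv e z : H →ₗ[ℝ] E).normDet * g (e.symm z)) := by
  have hK : IsCompact (e '' tsupport g) :=
    hgc.isCompact.image_of_continuousOn (e.continuousOn.mono hge)
  have hzero : ∀ z ∉ e '' tsupport g, e.target.indicator (fun z =>
      (sliceFDeriv e z : H →ₗ[ℝ] E).normDet * g (e.symm z)) z = 0 := fun z hz => by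
    refine indicator_apply_eq_zero.2 fun hzt => ?_
    rw [image_eq_zero_of_notMem_tsupport fun h => hz ⟨e.symm z, h, e.right_inv hzt⟩, mul_zero]
  refine ⟨contDiff_of_contDiffOn_of_eq_zero hK.isClosed e.open_target
    (e.mapsTo.mono_left hge).image_subset ?_ hzero, HasCompactSupport.intro hK hzero⟩
  exact (he.contDiffOn_normDet_sliceFDeriv.mul
    (hg.comp_contDiffOn he.contDiffOn_symm)).congr fun z hz => indicator_of_mem hz _

variable [MeasurableSpace E] [BorelSpace E]

theorem integrableOn_levelSet_iff_and_setIntegral_levelSet (he : IsLevelChart U ψ H e)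
    (hU : IsOpen U) (hψ : ContinuousOn ψ U) {g : E → ℝ} (hg : Continuous g)
    (hge : tsupport g ⊆ e.source) (v : ℝ) :
    (IntegrableOn g (levelSet U ψ v) μHE[finrank ℝ H] ↔
      Integrable fun y => e.target.indicator
        (fun z => (sliceFDeriv e z : H →ₗ[ℝ] E).normDet * g (e.symm z)) (v, y)) ∧
    ∫ x in levelSet U ψ v, g x ∂μHE[finrank ℝ H] =
      ∫ y, e.target.indicator
        (fun z => (sliceFDeriv e z : H →ₗ[ℝ] E).normDet * g (e.symm z)) (v, y) := by
  have hm : MeasurableSet (levelSet U ψ v) := measurableSet_levelSet hU hψ v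
  have harea := integrableOn_image_iff_and_setIntegral_image (isOpen_slice e v)
    H.orthogonalProjectionOnto.continuous (fun y hy => (he.apply_symm hy).2)
    (fun y => he.hasStrictFDerivAt_slice) (fun y => he.injective_sliceFDeriv)
    (he.contDiffOn_normDet_sliceFDeriv.continuousOn.comp
      (by fun_prop : Continuous fun y : H => (v, y)).continuousOn fun y hy => hy)
    (by rw [he.image_slice]; exact hm.inter e.open_source.measurableSet) hg.continuousOn
  rw [he.image_slice] at harea
  have hzero : ∀ x ∈ levelSet U ψ v \ (levelSet U ψ v ∩ e.source), g x = 0 := fun x hx =>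
    image_eq_zero_of_notMem_tsupport fun h => hx.2 ⟨hx.1, hge h⟩
  change (_ ↔ Integrable ({y | (v, y) ∈ e.target}.indicator _)) ∧
    _ = ∫ y, {y | (v, y) ∈ e.target}.indicator
      (fun y => (sliceFDeriv e (v, y) : H →ₗ[ℝ] E).normDet * g (e.symm (v, y))) y
  rw [integrable_indicator_iff (isOpen_slice e v).measurableSet,
    integral_indicator (isOpen_slice e v).measurableSet,
    setIntegral_eq_of_subset_of_forall_sdiff_eq_zero hm inter_subset_left hzero]
  exact ⟨⟨fun h => harea.1.1 (h.mono_set inter_subset_left),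
    fun h => (harea.1.2 h).of_forall_sdiff_eq_zero hm hzero⟩, harea.2⟩

end IsLevelChart

variable [MeasurableSpace E] [BorelSpace E] {U : Set E} {ψ : E → ℝ}

theorem exists_nhds_contDiff_setIntegral_levelSet (hU : IsOpen U) (hψ : ContDiffOn ℝ ∞ ψ U)
    {p : E} (hp : p ∈ regularSet U ψ) :
    ∃ W, IsOpen W ∧ p ∈ W ∧ ∀ g : E → ℝ, ContDiff ℝ ∞ g → HasCompactSupport g →
      tsupport g ⊆ W →
      (∀ v, IntegrableOn g (levelSet U ψ v) μHE[finrank ℝ E - 1]) ∧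
      ContDiff ℝ ∞ fun v => ∫ x in levelSet U ψ v, g x ∂μHE[finrank ℝ E - 1] := by
  obtain ⟨H, e, hpe, he⟩ := exists_isLevelChart hU hψ hp
  refine ⟨e.source, e.open_source, hpe, fun g hg hgc hge => ?_⟩
  obtain ⟨hk, hkc⟩ := he.contDiff_and_hasCompactSupport_indicator hg hgc hge
  have hlevel := he.integrableOn_levelSet_iff_and_setIntegral_levelSet hU hψ.continuousOn
    hg.continuous hge
  rw [← he.finrank_add_one, Nat.add_sub_cancel]
  refine ⟨fun v => (hlevel v).1.2 ?_, ?_⟩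
  · have hslice : Continuous fun y : H => (v, y) := by fun_prop
    exact (hk.continuous.comp hslice).integrable_of_hasCompactSupport
      (HasCompactSupport.intro (hkc.isCompact.image continuous_snd) fun y hy =>
        image_eq_zero_of_notMem_tsupport (x := (v, y)) fun h => hy ⟨(v, y), h, rfl⟩)
  · simp_rw [fun v => (hlevel v).2]
    exact contDiff_integral_of_hasCompactSupport hk hkc

theorem contDiff_setIntegral_levelSet_of_tsupport_subset (hU : IsOpen U)
    (hψ : ContDiffOn ℝ ∞ ψ U) {g : E → ℝ} (hg : ContDiff ℝ ∞ g) (hgc : HasCompactSupport g)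
    (hgs : tsupport g ⊆ regularSet U ψ) :
    (∀ v, IntegrableOn g (levelSet U ψ v) μHE[finrank ℝ E - 1]) ∧
      ContDiff ℝ ∞ fun v => ∫ x in levelSet U ψ v, g x ∂μHE[finrank ℝ E - 1] := by
  choose W hWo hpW hW using fun p : tsupport g =>
    exists_nhds_contDiff_setIntegral_levelSet hU hψ (hgs p.2)
  obtain ⟨t, h, hh, hgsum⟩ := exists_finset_contDiff_sum_eq hg hgc hWo
    (fun x hx => mem_iUnion.2 ⟨⟨x, hx⟩, hpW ⟨x, hx⟩⟩)
  have hI := fun i => hW i (h i) (hh i).1 (hh i).2.1 (hh i).2.2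
  rw [hgsum]
  refine ⟨fun v => integrable_finsetSum _ fun i _ => (hI i).1 v, ?_⟩
  simp_rw [fun v => integral_finsetSum t fun i _ => (hI i).1 v]
  exact ContDiff.sum fun i _ => (hI i).2

theorem contDiffAt_setIntegral_levelSet (hU : IsOpen U) (hψ : ContDiffOn ℝ ∞ ψ U) {g : E → ℝ}
    (hg : ContDiffOn ℝ ∞ g (regularSet U ψ)) {Q : Set E} (hQ : IsCompact Q)
    (hQR : Q ⊆ regularSet U ψ) {w : ℝ} (hev : ∀ᶠ v in 𝓝 w, levelSet U ψ v ⊆ Q) :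
    IntegrableOn g (levelSet U ψ w) μHE[finrank ℝ E - 1] ∧
      ContDiffAt ℝ ∞ (fun v => ∫ x in levelSet U ψ v, g x ∂μHE[finrank ℝ E - 1]) w := by
  obtain ⟨g', hg', hgc', hgs', heq⟩ :=
    exists_contDiff_eqOn_of_isCompact (isOpen_regularSet hU hψ) hQ hQR hg
  have hm := fun v => measurableSet_levelSet hU hψ.continuousOn v
  obtain ⟨hint, hsmooth⟩ := contDiff_setIntegral_levelSet_of_tsupport_subset hU hψ hg' hgc' hgs'
  refine ⟨(hint w).congr_fun (heq.mono hev.self_of_nhds) (hm w),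
    hsmooth.contDiffAt.congr_of_eventuallyEq ?_⟩
  filter_upwards [hev] with v hv
  exact setIntegral_congr_fun (hm v) (heq.symm.mono hv)

end LevelIntegral

section CriticalPoint

open Asymptotics

variable {E : Type*} [NormedAddCommGroup E] [NormedSpace ℝ E]

theorem isLittleO_norm_sq_of_hasFDerivAt {F : Type*} [NormedAddCommGroup F] [NormedSpace ℝ F]
    {r : E → F} {r' : E → E →L[ℝ] F} (h0 : r 0 = 0) (hr : ∀ᶠ ξ in 𝓝 0, HasFDerivAt r (r' ξ) ξ)
    (hr' : r' =o[𝓝 0] fun ξ => ξ) : r =o[𝓝 0] fun ξ => ‖ξ‖ ^ 2 := by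
  refine isLittleO_iff.2 fun ε hε => ?_
  obtain ⟨δ, hδ, hball⟩ := Metric.eventually_nhds_iff_ball.1 (hr.and (hr'.def hε))
  filter_upwards [Metric.ball_mem_nhds 0 hδ] with ξ hξ
  have hsub : Metric.closedBall (0 : E) ‖ξ‖ ⊆ Metric.ball 0 δ :=
    Metric.closedBall_subset_ball (mem_ball_zero_iff.1 hξ)
  have hbound : ∀ ζ ∈ Metric.closedBall (0 : E) ‖ξ‖, ‖r' ζ‖ ≤ ε * ‖ξ‖ := fun ζ hζ =>
    (hball ζ (hsub hζ)).2.trans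
      (mul_le_mul_of_nonneg_left (mem_closedBall_zero_iff.1 hζ) hε.le)
  have hmv := (convex_closedBall (0 : E) ‖ξ‖).norm_image_sub_le_of_norm_hasFDerivWithin_le
    (fun ζ hζ => (hball ζ (hsub hζ)).1.hasFDerivWithinAt) hbound
    (Metric.mem_closedBall_self (norm_nonneg ξ)) (mem_closedBall_zero_iff.2 le_rfl)
  calc ‖r ξ‖ = ‖r ξ - r 0‖ := by rw [h0, sub_zero]
    _ ≤ ε * ‖ξ‖ * ‖ξ - 0‖ := hmv
    _ = ε * ‖‖ξ‖ ^ 2‖ := by rw [sub_zero, norm_pow, norm_norm]; ring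

theorem isLittleO_sub_fderiv_sub_half_fderiv_fderiv {F : Type*} [NormedAddCommGroup F]
    [NormedSpace ℝ F] {ψ : E → F} {p : E} (hψ : ContDiffAt ℝ 2 ψ p) :
    (fun ξ => ψ (p + ξ) - ψ p - fderiv ℝ ψ p ξ - (2⁻¹ : ℝ) • fderiv ℝ (fderiv ℝ ψ) p ξ ξ)
      =o[𝓝 0] fun ξ => ‖ξ‖ ^ 2 := by
  let B := fderiv ℝ (fderiv ℝ ψ) p
  have hsymm : ∀ u w, B u w = B w u := hψ.isSymmSndFDerivAt (by simp)
  have hB : HasFDerivAt (fderiv ℝ ψ) B p :=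
    ((hψ.fderiv_right (m := 1) (by norm_num)).differentiableAt (by simp)).hasFDerivAt
  have hdiff : ∀ᶠ ξ in 𝓝 (0 : E), DifferentiableAt ℝ ψ (p + ξ) :=
    ((continuous_const_add p).tendsto' 0 p (add_zero p)).eventually
      ((hψ.eventually (by simp)).mono fun x hx => hx.differentiableAt (by simp))
  refine isLittleO_norm_sq_of_hasFDerivAt (by simp) ?_ (hasFDerivAt_iff_isLittleO_nhds_zero.1 hB)
  filter_upwards [hdiff] with ξ hξ
  have hshift : HasFDerivAt (fun ξ => ψ (p + ξ)) (fderiv ℝ ψ (p + ξ)) ξ :=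
    (hasFDerivAt_comp_add_left p).2 hξ.hasFDerivAt
  have hquad : HasFDerivAt (fun ξ => (2⁻¹ : ℝ) • B ξ ξ) (B ξ) ξ := by
    refine ((B.hasFDerivAt.clm_apply (hasFDerivAt_id ξ)).const_smul (2⁻¹ : ℝ)).congr_fderiv ?_
    ext u
    simp [hsymm u ξ, ← add_smul, ← one_div]
  exact ((hshift.sub_const _).sub (fderiv ℝ ψ p).hasFDerivAt).sub hquad

variable {ψ : E → ℝ} {p : E}

theorem tendsto_sq_mul_sub_of_fderiv_eq_zero (hψ : ContDiffAt ℝ 2 ψ p) (hp : fderiv ℝ ψ p = 0)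
    {α : Type*} {l : Filter α} {c : α → ℝ} {d : α → E} {u : E} (hd : Tendsto d l (𝓝 0))
    (hcd : Tendsto (fun n => c n • d n) l (𝓝 u)) :
    Tendsto (fun n => c n ^ 2 * (ψ (p + d n) - ψ p)) l
      (𝓝 (2⁻¹ * fderiv ℝ (fderiv ℝ ψ) p u u)) := by
  let B := fderiv ℝ (fderiv ℝ ψ) p
  have hrem : (fun n => c n ^ 2 * (ψ (p + d n) - ψ p - fderiv ℝ ψ p (d n) -
      (2⁻¹ : ℝ) • B (d n) (d n))) =o[l] fun _ => (1 : ℝ) := by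
    refine ((isBigO_refl (fun n => c n ^ 2) l).mul_isLittleO
      ((isLittleO_sub_fderiv_sub_half_fderiv_fderiv hψ).comp_tendsto hd)).trans_isBigO ?_
    refine ((hcd.isBigO_one ℝ).norm_left.pow 2).congr (fun n => ?_) fun _ => one_pow 2
    rw [Function.comp_apply, norm_smul, mul_pow, Real.norm_eq_abs, sq_abs]
  have hquad : Tendsto (fun n => 2⁻¹ * B (c n • d n) (c n • d n)) l (𝓝 (2⁻¹ * B u u)) :=
    ((by fun_prop : Continuous fun u => 2⁻¹ * B u u).tendsto u).comp hcd
  have hsum := ((isLittleO_one_iff ℝ).1 hrem).add hquad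
  rw [zero_add] at hsum
  refine hsum.congr fun n => ?_
  simp only [hp, zero_apply, map_smul, smul_apply, smul_eq_mul]
  ring

theorem fderiv_fderiv_apply_self_eq_zero_of_mem_tangentConeAt (hψ : ContDiffAt ℝ 2 ψ p)
    (hp : fderiv ℝ ψ p = 0) {u : E} (hu : u ∈ tangentConeAt ℝ {x | ψ x = ψ p} p) :
    fderiv ℝ (fderiv ℝ ψ) p u u = 0 := by
  obtain ⟨α, l, _, c, d, hd, hlevel, hcd⟩ := exists_fun_of_mem_tangentConeAt hu
  have hzero : ∀ᶠ n in l, c n ^ 2 * (ψ (p + d n) - ψ p) = 0 :=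
    hlevel.mono fun n hn => by rw [show ψ (p + d n) = ψ p from hn, sub_self, mul_zero]
  simpa using tendsto_nhds_unique
    ((tendsto_sq_mul_sub_of_fderiv_eq_zero hψ hp hd hcd).congr' hzero) tendsto_const_nhds

theorem tendsto_inv_sq_mul_sub_of_fderiv_eq_zero (hψ : ContDiffAt ℝ 2 ψ p)
    (hp : fderiv ℝ ψ p = 0) (u : E) :
    Tendsto (fun t : ℝ => t⁻¹ ^ 2 * (ψ (p + t • u) - ψ p)) (𝓝[>] 0)
      (𝓝 (2⁻¹ * fderiv ℝ (fderiv ℝ ψ) p u u)) := by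
  refine tendsto_sq_mul_sub_of_fderiv_eq_zero hψ hp ?_ (tendsto_const_nhds.congr' ?_)
  · have hline : Continuous fun t : ℝ => t • u := by fun_prop
    exact (hline.tendsto' 0 0 (zero_smul ℝ u)).mono_left nhdsWithin_le_nhds
  · filter_upwards [self_mem_nhdsWithin] with t (ht : 0 < t)
    rw [inv_smul_smul₀ ht.ne']

theorem eventually_exists_mem_Icc_apply_eq (hψ : ContDiffAt ℝ 2 ψ p) (hp : fderiv ℝ ψ p = 0)
    {w n : E} {s : ℝ} (hs : 0 ≤ s)
    (hneg : fderiv ℝ (fderiv ℝ ψ) p (w + (-s) • n) (w + (-s) • n) < 0)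
    (hpos : 0 < fderiv ℝ (fderiv ℝ ψ) p (w + s • n) (w + s • n)) :
    ∀ᶠ t : ℝ in 𝓝[>] 0, ∃ s' ∈ Icc (-s) s, ψ (p + t • (w + s' • n)) = ψ p := by
  have hcont : ∀ᶠ t : ℝ in 𝓝 0, ∀ s' ∈ Icc (-s) s,
      ContinuousAt ψ (p + t • (w + s' • n)) := by
    refine isCompact_Icc.eventually_forall_of_forall_eventually fun s' _ => ?_
    have hmap : Continuous fun z : ℝ × ℝ => p + z.1 • (w + z.2 • n) := by fun_prop
    exact (hmap.tendsto' (0, s') p (by simp)).eventually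
      ((hψ.eventually (by simp)).mono fun x hx => hx.continuousAt)
  filter_upwards [hcont.filter_mono nhdsWithin_le_nhds,
    (tendsto_inv_sq_mul_sub_of_fderiv_eq_zero hψ hp _).eventually
      (gt_mem_nhds (mul_neg_of_pos_of_neg (by norm_num) hneg)),
    (tendsto_inv_sq_mul_sub_of_fderiv_eq_zero hψ hp _).eventually
      (lt_mem_nhds (mul_pos (by norm_num) hpos))] with t hct hbelow habove
  have hle : ψ (p + t • (w + (-s) • n)) ≤ ψ p :=
    (sub_neg.1 (neg_of_mul_neg_right hbelow (sq_nonneg _))).le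
  have hge : ψ p ≤ ψ (p + t • (w + s • n)) :=
    (sub_pos.1 (pos_of_mul_pos_right habove (sq_nonneg _))).le
  have hslice : ContinuousOn (fun s' => ψ (p + t • (w + s' • n))) (Icc (-s) s) := fun s' hs' =>
    (ContinuousAt.comp (f := fun s' : ℝ => p + t • (w + s' • n)) (hct s' hs')
      (by fun_prop)).continuousWithinAt
  exact intermediate_value_Icc (neg_le_self hs) hslice ⟨hle, hge⟩

theorem exists_eventually_apply_self_neg_and_pos {B : E →L[ℝ] E →L[ℝ] ℝ}
    (hsymm : ∀ u w, B u w = B w u) {w : E} (hw : B w w = 0) (hBw : B w ≠ 0) :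
    ∃ n, ∀ᶠ s : ℝ in 𝓝[>] 0,
      B (w + (-s) • n) (w + (-s) • n) < 0 ∧ 0 < B (w + s • n) (w + s • n) := by
  obtain ⟨n, hn⟩ : ∃ n, 0 < B w n := by
    obtain ⟨n, hn⟩ := DFunLike.ne_iff.1 hBw
    rcases lt_or_gt_of_ne hn with h | h
    · exact ⟨-n, by simpa using h⟩
    · exact ⟨n, h⟩
  have hBsum : ∀ s : ℝ, B (w + s • n) (w + s • n) = s * (2 * B w n + s * B n n) := fun s => by
    simp only [map_add, map_smul, add_apply, smul_apply, smul_eq_mul, hsymm n w, hw]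
    ring
  have hfactor : ∀ᶠ s : ℝ in 𝓝 0, 0 < 2 * B w n + s * B n n :=
    ((by fun_prop : Continuous fun s : ℝ => 2 * B w n + s * B n n).tendsto' 0 (2 * B w n)
      (by simp)).eventually_const_lt (by positivity)
  have hneg : Tendsto (fun s : ℝ => -s) (𝓝[>] 0) (𝓝 0) :=
    (continuous_neg.tendsto' (0 : ℝ) 0 neg_zero).mono_left nhdsWithin_le_nhds
  refine ⟨n, ?_⟩
  simp_rw [hBsum]
  filter_upwards [self_mem_nhdsWithin, hfactor.filter_mono nhdsWithin_le_nhds,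
    hneg.eventually hfactor] with s (hs : 0 < s) hplus hminus
  exact ⟨mul_neg_of_neg_of_pos (neg_neg_of_pos hs) hminus, mul_pos hs hplus⟩

theorem mem_tangentConeAt_of_fderiv_fderiv_apply_self_eq_zero (hψ : ContDiffAt ℝ 2 ψ p)
    (hp : fderiv ℝ ψ p = 0) {w : E} (hw : fderiv ℝ (fderiv ℝ ψ) p w w = 0)
    (hw' : fderiv ℝ (fderiv ℝ ψ) p w ≠ 0) : w ∈ tangentConeAt ℝ {x | ψ x = ψ p} p := by
  obtain ⟨n, hn⟩ :=
    exists_eventually_apply_self_neg_and_pos (hψ.isSymmSndFDerivAt (by simp)) hw hw'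
  refine mem_tangentConeAt_of_frequently (𝓝[>] (0 : ℝ) ×ˢ 𝓝 (0 : ℝ)) (fun z => z.1⁻¹)
    (fun z => z.1 • (w + z.2 • n)) ?_ (fun hoff => ?_) ?_
  · have hmap : Continuous fun z : ℝ × ℝ => z.1 • (w + z.2 • n) := by fun_prop
    refine (hmap.tendsto' (0, 0) 0 (by simp)).mono_left ?_
    rw [nhds_prod_eq]
    exact prod_mono nhdsWithin_le_nhds le_rfl
  · obtain ⟨T, hT, S, hS, hTS⟩ := eventually_prod_iff.1 hoff
    obtain ⟨ε, hε, hball⟩ := Metric.eventually_nhds_iff_ball.1 hS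
    obtain ⟨s, ⟨hneg, hpos⟩, hs⟩ := (hn.and (Ioo_mem_nhdsGT hε)).exists
    obtain ⟨t, htT, s', hs', hts⟩ :=
      (hT.and (eventually_exists_mem_Icc_apply_eq hψ hp hs.1.le hneg hpos)).exists
    exact hTS htT (hball s' (mem_ball_zero_iff.2 ((abs_le.2 hs').trans_lt hs.2))) hts
  · have hlim : Tendsto (fun z : ℝ × ℝ => w + z.2 • n) (𝓝[>] 0 ×ˢ 𝓝 0) (𝓝 w) :=
      ((by fun_prop : Continuous fun s : ℝ => w + s • n).tendsto' 0 w (by simp)).comp tendsto_snd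
    refine hlim.congr' ?_
    filter_upwards [tendsto_fst.eventually self_mem_nhdsWithin] with z (hz : 0 < z.1)
    rw [inv_smul_smul₀ hz.ne']

theorem exists_apply_self_eq_zero_and_apply_ne_zero {B : E →L[ℝ] E →L[ℝ] ℝ}
    (hsymm : ∀ u w, B u w = B w u) {a : E} (ha : B a a = 0) (hBa : B a ≠ 0) :
    ∃ w, B w w = 0 ∧ B a w ≠ 0 := by
  obtain ⟨n, hn⟩ := DFunLike.ne_iff.1 hBa
  rw [zero_apply] at hn
  refine ⟨n - (B n n / (2 * B a n)) • a, ?_, by simpa [ha] using hn⟩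
  simp only [map_sub, map_smul, sub_apply, smul_apply, smul_eq_mul, hsymm n a, ha]
  field_simp
  ring

theorem fderiv_ne_zero_of_hasFDerivAt_parametrization {H : Type*} [NormedAddCommGroup H]
    [NormedSpace ℝ H] [Nontrivial H] (hψ : ContDiffAt ℝ 2 ψ p)
    (hnd : ∀ u, (∀ w, fderiv ℝ (fderiv ℝ ψ) p u w = 0) → u = 0)
    {g : H → E} {h : E → H} {y : H} {P : H →L[ℝ] E} {Q : E →L[ℝ] H}
    (hg : HasFDerivAt g P y) (hh : HasFDerivAt h Q p) (hy : g y = p)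
    (hlevel : ∀ᶠ z in 𝓝 y, ψ (g z) = ψ p) (hhg : ∀ᶠ z in 𝓝 y, h (g z) = z)
    (hgh : ∀ᶠ x in 𝓝 p, ψ x = ψ p → g (h x) = x) : fderiv ℝ ψ p ≠ 0 := by
  intro hp
  subst hy
  let B := fderiv ℝ (fderiv ℝ ψ) (g y)
  have hsymm : ∀ u w, B u w = B w u := hψ.isSymmSndFDerivAt (by simp)
  have hQP : Q.comp P = .id ℝ H :=
    (hh.comp y hg).unique ((hasFDerivAt_id y).congr_of_eventuallyEq hhg)
  have hcone : ∀ u, P u ∈ tangentConeAt ℝ {x | ψ x = ψ (g y)} (g y) := fun u => by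
    have himage := hg.hasFDerivWithinAt.mapsTo_tangent_cone (s := {z | ψ (g z) = ψ (g y)})
      (by rw [tangentConeAt_of_mem_nhds hlevel]; exact mem_univ u)
    exact tangentConeAt_mono (image_subset_iff.2 fun z hz => hz) himage
  have hself : ∀ u, B (P u) (P u) = 0 := fun u =>
    fderiv_fderiv_apply_self_eq_zero_of_mem_tangentConeAt hψ hp (hcone u)
  have hrange : ∀ u u', B (P u) (P u') = 0 := fun u u' => by
    have hpolar := hself (u + u')
    simp only [map_add, add_apply, hself, hsymm (P u') (P u)] at hpolar
    linarith
  have hPQ : EqOn (P.comp Q) (ContinuousLinearMap.id ℝ E)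
      (tangentConeAt ℝ {x | ψ x = ψ (g y)} (g y)) := by
    refine HasFDerivWithinAt.unique_on ?_ (hasFDerivWithinAt_id (g y) _)
    have hgP : HasFDerivAt g P (h (g y)) := by rwa [hhg.self_of_nhds]
    refine (hgP.comp (g y) hh).hasFDerivWithinAt.congr_of_eventuallyEq ?_
      (congrArg g hhg.self_of_nhds).symm
    filter_upwards [self_mem_nhdsWithin, hgh.filter_mono nhdsWithin_le_nhds] with x hx hghx
    exact (hghx hx).symm
  obtain ⟨u, hu⟩ := exists_ne (0 : H)
  have hPu : B (P u) ≠ 0 := fun h => hu <| by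
    have hQPu : Q (P u) = u := DFunLike.congr_fun hQP u
    rw [← hQPu, hnd (P u) (DFunLike.congr_fun h), map_zero]
  obtain ⟨w, hww, hw⟩ := exists_apply_self_eq_zero_and_apply_ne_zero hsymm (hself u) hPu
  have hBw : B w ≠ 0 := fun h => hw (by rw [hsymm, h, zero_apply])
  have hwP : P (Q w) = w :=
    hPQ (mem_tangentConeAt_of_fderiv_fderiv_apply_self_eq_zero hψ hp hww hBw)
  exact hw (hwP ▸ hrange u (Q w))

end CriticalPoint

section Submanifold

variable {E F : Type*} [NormedAddCommGroup E] [NormedSpace ℝ E] [NormedAddCommGroup F]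
  [NormedSpace ℝ F]

theorem SmoothOnSubset.exists_contDiffAt_eventuallyEq {f : E → F} {A : Set E}
    (hf : SmoothOnSubset f A) {x : E} (hx : x ∈ A) :
    ∃ f' : E → F, ContDiffAt ℝ ∞ f' x ∧ f =ᶠ[𝓝[A] x] f' := by
  obtain ⟨O, f', hO, hxO, hf', hff'⟩ := hf x hx
  refine ⟨f', hf'.contDiffAt (hO.mem_nhds hxO), ?_⟩
  filter_upwards [self_mem_nhdsWithin, mem_nhdsWithin_of_mem_nhds (hO.mem_nhds hxO)] with y hyA hyO
  exact hff' ⟨hyA, hyO⟩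

theorem SmoothOnSubset.continuousOn {f : E → F} {A : Set E} (hf : SmoothOnSubset f A) :
    ContinuousOn f A := fun x hx => by
  obtain ⟨f', hf', hff'⟩ := hf.exists_contDiffAt_eventuallyEq hx
  exact hf'.continuousAt.continuousWithinAt.congr_of_eventuallyEq hff' (hff'.self_of_nhdsWithin hx)

/-- Near `p` the set `A` is an embedded smooth submanifold modelled on `H`: it is parametrized by a
smooth map `g` having a smooth left inverse `h`. -/
def IsSubmanifoldAt (H : Type*) [NormedAddCommGroup H] [NormedSpace ℝ H] (A : Set E) (p : E) :
    Prop :=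
  ∃ (g : H → E) (h : E → H), ContDiffAt ℝ ∞ g (h p) ∧ ContDiffAt ℝ ∞ h p ∧ g (h p) = p ∧
    (∀ᶠ z in 𝓝 (h p), g z ∈ A ∧ h (g z) = z) ∧ ∀ᶠ x in 𝓝[A] p, g (h x) = x

theorem IsSubmanifoldAt.image {H : Type*} [NormedAddCommGroup H] [NormedSpace ℝ H] {A : Set E}
    {B : Set F} {f : E → F} {k : F → E} (hf : SmoothOnSubset f A) (hk : SmoothOnSubset k B)
    (hfAB : MapsTo f A B) (hkBA : MapsTo k B A) (hkf : LeftInvOn k f A) (hfk : RightInvOn k f B)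
    {p : F} (hp : p ∈ B) (hA : IsSubmanifoldAt H A (k p)) : IsSubmanifoldAt H B p := by
  obtain ⟨g, h, hg, hh, hghp, hghz, hghx⟩ := hA
  obtain ⟨f', hf', hff'⟩ := hf.exists_contDiffAt_eventuallyEq (hkBA hp)
  obtain ⟨k', hk', hkk'⟩ := hk.exists_contDiffAt_eventuallyEq hp
  have hkp : k' p = k p := (hkk'.self_of_nhdsWithin hp).symm
  have hf'p : f' (k p) = p := by rw [← hff'.self_of_nhdsWithin (hkBA hp), hfk hp]
  have hf'g : ContDiffAt ℝ ∞ (fun z => f' (g z)) (h (k p)) :=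
    ContDiffAt.comp _ (hghp.symm ▸ hf') hg
  have hgA : Tendsto g (𝓝 (h (k p))) (𝓝[A] (k p)) :=
    tendsto_nhdsWithin_iff.2 ⟨by simpa [ContinuousAt, hghp] using hg.continuousAt,
      hghz.mono fun z hz => hz.1⟩
  have hfg : ∀ᶠ z in 𝓝 (h (k p)), f' (g z) = f (g z) :=
    (hgA.eventually hff').mono fun z hz => hz.symm
  have hf'gB : Tendsto (fun z => f' (g z)) (𝓝 (h (k p))) (𝓝[B] p) := by
    refine tendsto_nhdsWithin_iff.2
      ⟨by simpa [ContinuousAt, hghp, hf'p] using hf'g.continuousAt, ?_⟩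
    filter_upwards [hfg, hghz] with z hz hgz
    exact hz ▸ hfAB hgz.1
  have hkA : Tendsto k (𝓝[B] p) (𝓝[A] (k p)) := (hk.continuousOn p hp).tendsto_nhdsWithin hkBA
  refine ⟨fun z => f' (g z), fun x => h (k' x), ?_, ContDiffAt.comp p (hkp.symm ▸ hh) hk', ?_, ?_,
    ?_⟩
  · simpa only [hkp] using hf'g
  · simp only [hkp, hghp, hf'p]
  · simp only [hkp]
    filter_upwards [hfg, hf'gB.eventually hkk', hghz] with z hz hkz hgz
    rw [← hkz, hz, hkf hgz.1]
    exact ⟨hfAB hgz.1, hgz.2⟩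
  · filter_upwards [hkk', hkA.eventually hghx, hkA.eventually hff', self_mem_nhdsWithin]
      with x hkx hghkx hfkx hxB
    rw [← hkx, hghkx, ← hfkx, hfk hxB]

theorem IsSubmanifoldAt.fderiv_ne_zero {H : Type*} [NormedAddCommGroup H] [NormedSpace ℝ H]
    [Nontrivial H] {U : Set E} {ψ : E → ℝ} {p : E} (hU : IsOpen U) (hψ : ContDiffOn ℝ 2 ψ U)
    (hp : p ∈ U) (hnd : ∀ u, (∀ w, fderiv ℝ (fderiv ℝ ψ) p u w = 0) → u = 0)
    (hsub : IsSubmanifoldAt H (levelSet U ψ (ψ p)) p) : fderiv ℝ ψ p ≠ 0 := by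
  obtain ⟨g, h, hg, hh, hghp, hghz, hghx⟩ := hsub
  refine fderiv_ne_zero_of_hasFDerivAt_parametrization (hψ.contDiffAt (hU.mem_nhds hp)) hnd
    (hg.differentiableAt (by simp)).hasFDerivAt (hh.differentiableAt (by simp)).hasFDerivAt hghp
    (hghz.mono fun z hz => hz.1.2) (hghz.mono fun z hz => hz.2) ?_
  filter_upwards [eventually_nhdsWithin_iff.1 hghx, hU.mem_nhds hp] with x hx hxU hxp
  exact hx ⟨hxU, hxp⟩

end Submanifold

theorem IsLevelChart.isSubmanifoldAt {E : Type*} [NormedAddCommGroup E] [InnerProductSpace ℝ E]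
    [FiniteDimensional ℝ E] {U : Set E} {ψ : E → ℝ} {H : Submodule ℝ E}
    {e : OpenPartialHomeomorph E (ℝ × H)} (he : IsLevelChart U ψ H e) {p : E} (hp : p ∈ e.source) :
    IsSubmanifoldAt H (levelSet U ψ (ψ p)) p := by
  obtain ⟨hpe, hsymm⟩ := he.symm_eq hp
  refine ⟨fun y => e.symm (ψ p, y), fun x => H.orthogonalProjectionOnto x, ?_,
    H.orthogonalProjectionOnto.contDiff.contDiffAt, hsymm, ?_, ?_⟩
  · exact (he.contDiffAt_symm hpe).comp _ (by fun_prop)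
  · filter_upwards [(isOpen_slice e (ψ p)).mem_nhds hpe] with y hy
    exact ⟨⟨he.source_subset (e.map_target hy), (he.apply_symm hy).1⟩, (he.apply_symm hy).2⟩
  · filter_upwards [self_mem_nhdsWithin, mem_nhdsWithin_of_mem_nhds (e.open_source.mem_nhds hp)]
      with x hx hxe
    rw [← hx.2]
    exact (he.symm_eq hxe).2

section Morse

theorem MorseOn.mono {E : Type*} [NormedAddCommGroup E] [NormedSpace ℝ E] {ψ : E → ℝ} {S T : Set E}
    (hT : MorseOn ψ T) (hST : S ⊆ T) : MorseOn ψ S :=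
  fun x hx => hT x (hST hx)

theorem eventually_fderiv_ne_zero_of_nondegenerate {E : Type*} [NormedAddCommGroup E]
    [NormedSpace ℝ E] [FiniteDimensional ℝ E] {ψ : E → ℝ} {p : E} (hψ : ContDiffAt ℝ 2 ψ p)
    (hnd : ∀ u, (∀ w, fderiv ℝ (fderiv ℝ ψ) p u w = 0) → u = 0) :
    ∀ᶠ x in 𝓝[≠] p, fderiv ℝ ψ x ≠ 0 := by
  have hd : HasFDerivAt (fderiv ℝ ψ) (fderiv ℝ (fderiv ℝ ψ) p) p :=
    ((hψ.fderiv_right (m := 1) (by norm_num)).differentiableAt (by simp)).hasFDerivAt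
  obtain ⟨K, -, hK⟩ := (fderiv ℝ (fderiv ℝ ψ) p).toLinearMap.exists_antilipschitzWith
    (LinearMap.ker_eq_bot'.2 fun u hu => hnd u fun w => DFunLike.congr_fun hu w)
  exact hd.eventually_ne ⟨K, hK⟩

theorem MorseOn.countable_setOf_fderiv_eq_zero {E : Type*} [NormedAddCommGroup E]
    [NormedSpace ℝ E] [FiniteDimensional ℝ E] {U S : Set E} {ψ : E → ℝ} (hM : MorseOn ψ S)
    (hU : IsOpen U) (hψ : ContDiffOn ℝ 2 ψ U) (hS : S ⊆ U) :
    {x ∈ S | fderiv ℝ ψ x = 0}.Countable := by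
  refine (HereditarilyLindelofSpace.isLindelof _).countable (discreteTopology_subtype_iff.2 ?_)
  intro x hx
  rw [← disjoint_iff, disjoint_principal_right]
  filter_upwards [eventually_fderiv_ne_zero_of_nondegenerate
    (hψ.contDiffAt (hU.mem_nhds (hS hx.1))) (hM x hx.1 hx.2)] with y hy h
  exact hy h.2

variable {E : Type*} [NormedAddCommGroup E] [InnerProductSpace ℝ E] [FiniteDimensional ℝ E]
  {U : Set E} {ψ : E → ℝ} {v₀ v₁ : ℝ}

theorem MorseOn.exists_mem_Ioo_levelSet_subset_regularSet
    (hM : MorseOn ψ {x ∈ U | ψ x ∈ Ioo v₀ v₁}) (hU : IsOpen U) (hψ : ContDiffOn ℝ 2 ψ U)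
    (hv : v₀ < v₁) : ∃ v ∈ Ioo v₀ v₁, levelSet U ψ v ⊆ regularSet U ψ := by
  have hc := (hM.countable_setOf_fderiv_eq_zero hU hψ fun x hx => hx.1).image ψ
  obtain ⟨v, hv, hvI⟩ := (hc.dense_compl ℝ).exists_mem_open isOpen_Ioo (nonempty_Ioo.2 hv)
  refine ⟨v, hvI, fun x hx => ⟨hx.1, fun h0 => hv ⟨x, ⟨⟨hx.1, ?_⟩, h0⟩, hx.2⟩⟩⟩
  rwa [hx.2]

theorem MorseOn.levelSet_subset_regularSet (hM : MorseOn ψ {x ∈ U | ψ x ∈ Ioo v₀ v₁})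
    (hE : 2 ≤ finrank ℝ E) (hU : IsOpen U) (hψ : ContDiffOn ℝ ∞ ψ U)
    (hdiff : ∀ v ∈ Ioo v₀ v₁, ∀ v' ∈ Ioo v₀ v₁,
      DiffeomorphicSubsets (levelSet U ψ v) (levelSet U ψ v'))
    {v : ℝ} (hv : v ∈ Ioo v₀ v₁) : levelSet U ψ v ⊆ regularSet U ψ := by
  rintro p ⟨hpU, rfl⟩
  have hψ2 : ContDiffOn ℝ 2 ψ U := hψ.of_le (WithTop.coe_le_coe.2 le_top)
  obtain ⟨v', hv', hreg⟩ :=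
    hM.exists_mem_Ioo_levelSet_subset_regularSet hU hψ2 (hv.1.trans hv.2)
  obtain ⟨f, k, hf, hk, hfAB, hkBA, hkf, hfk⟩ :=
    hdiff v' hv' (ψ p) hv
  have hp : p ∈ levelSet U ψ (ψ p) := ⟨hpU, rfl⟩
  obtain ⟨H, e, hke, he⟩ := exists_isLevelChart hU hψ (hreg (hkBA hp))
  have : Nontrivial H := nontrivial_of_finrank_pos (R := ℝ) (by have := he.finrank_add_one; omega)
  have hsub : IsSubmanifoldAt H (levelSet U ψ v') (k p) := (hkBA hp).2 ▸ he.isSubmanifoldAt hke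
  refine ⟨hpU, fun h0 => ?_⟩
  exact (hsub.image hf hk hfAB hkBA hkf hfk hp).fderiv_ne_zero hU hψ2 hpU
    (hM p ⟨hpU, hv⟩ h0) h0

end Morse

section ClopenPieces

/-- The subset `S` is a disjoint union of `m` nonempty relatively clopen pieces, encoded as the
fibres of a locally constant function on `S`. -/
def HasClopenPieces {X : Type*} [TopologicalSpace X] (S : Set X) (m : ℕ) : Prop :=
  ∃ f : X → ℕ, ContinuousOn f S ∧ f '' S = Iio m

variable {X : Type*} [TopologicalSpace X]

theorem HasClopenPieces.of_image_eq {Y : Type*} [TopologicalSpace Y] {A : Set X} {B : Set Y}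
    {m : ℕ} (hA : HasClopenPieces A m) {h : Y → X} (hh : ContinuousOn h B) (hBA : h '' B = A) :
    HasClopenPieces B m := by
  obtain ⟨f, hf, hfA⟩ := hA
  refine ⟨f ∘ h, hf.comp hh (hBA ▸ mapsTo_image h B), ?_⟩
  rw [image_comp, hBA, hfA]

theorem exists_hasClopenPieces (S : Set X) : ∃ m, HasClopenPieces S m := by
  rcases S.eq_empty_or_nonempty with rfl | hS
  · exact ⟨0, fun _ => 0, continuousOn_const, by simp⟩
  · refine ⟨1, fun _ => 0, continuousOn_const, ?_⟩
    rw [hS.image_const]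
    ext i
    simp

theorem bddAbove_setOf_hasClopenPieces {S : Set X} (hS : IsCompact S)
    (hloc : ∀ p ∈ S, ∃ t ∈ 𝓝[S] p, t ⊆ S ∧ IsPreconnected t) :
    BddAbove {m | HasClopenPieces S m} := by
  choose! t ht htS htc using hloc
  obtain ⟨s, hsS, hcov⟩ := hS.elim_nhdsWithin_subcover t ht
  refine ⟨s.card, ?_⟩
  rintro m ⟨f, hf, hfS⟩
  have hsub : Finset.range m ⊆ s.image f := fun i hi => by
    obtain ⟨x, hx, rfl⟩ : i ∈ f '' S := hfS ▸ Finset.mem_range.1 hi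
    obtain ⟨p, hp, hxp⟩ := mem_iUnion₂.1 (hcov hx)
    have hpS := hsS p hp
    rw [(htc p hpS).constant (hf.mono (htS p hpS)) hxp (mem_of_mem_nhdsWithin hpS (ht p hpS))]
    exact Finset.mem_image_of_mem f hp
  simpa using (Finset.card_le_card hsub).trans Finset.card_image_le

theorem hasClopenPieces_succ {S Q O : Set X} {F : X → ℕ} {m : ℕ} (hQ : IsClosed Q) (hO : IsOpen O)
    (hOQ : O ⊆ Q) (hSO : S ∩ Q ⊆ O) (hF : ContinuousOn F O) (hFm : MapsTo F O (Iio m))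
    (hFS : Iio m ⊆ F '' (S ∩ O)) (hSQ : ¬S ⊆ Q) : HasClopenPieces S (m + 1) := by
  classical
  let f : X → ℕ := Q.piecewise F fun _ => m
  have hfO : EqOn f F O := (piecewise_eqOn Q F _).mono hOQ
  have hfQ : EqOn f (fun _ => m) Qᶜ := piecewise_eqOn_compl Q F _
  refine ⟨f, fun x hx => ContinuousAt.continuousWithinAt ?_, Subset.antisymm ?_ fun i hi => ?_⟩
  · by_cases hxQ : x ∈ Q
    · have hxO := hO.mem_nhds (hSO ⟨hx, hxQ⟩)
      exact (hF.continuousAt hxO).congr (eventually_of_mem hxO hfO.symm)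
    · exact continuousAt_const.congr (eventually_of_mem (hQ.isOpen_compl.mem_nhds hxQ) hfQ.symm)
  · rintro _ ⟨x, hx, rfl⟩
    by_cases hxQ : x ∈ Q
    · rw [hfO (hSO ⟨hx, hxQ⟩)]
      exact Nat.lt_succ_of_lt (hFm (hSO ⟨hx, hxQ⟩))
    · rw [hfQ hxQ]
      exact Nat.lt_succ_self m
  · rcases Nat.lt_succ_iff_lt_or_eq.1 hi with hi | rfl
    · obtain ⟨x, hx, rfl⟩ := hFS hi
      exact ⟨x, hx.1, hfO hx.2⟩
    · obtain ⟨x, hx, hxQ⟩ := not_subset.1 hSQ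
      exact ⟨x, hx, hfQ hxQ⟩

theorem exists_isOpen_continuousOn_eqOn [NormalSpace X] {S : Set X} (hS : IsClosed S) {f : X → ℕ}
    (hf : ContinuousOn f S) :
    ∃ (O : Set X) (F : X → ℕ), IsOpen O ∧ S ⊆ O ∧ ContinuousOn F O ∧ MapsTo F O (f '' S) ∧
      EqOn F f S := by
  -- Extend `f` to a real function by Tietze's theorem, and round.
  have hf' : ContinuousOn (fun x => (f x : ℝ)) S :=
    continuous_of_discreteTopology.comp_continuousOn hf
  obtain ⟨G, hG⟩ := ContinuousMap.exists_restrict_eq hS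
    ⟨_, continuousOn_iff_continuous_domRestrict.1 hf'⟩
  have hGf : ∀ x ∈ S, G x = f x := fun x hx => DFunLike.congr_fun hG ⟨x, hx⟩
  let N : ℕ → Set X := fun j => {x | |G x - j| < 1 / 2}
  have hN : ∀ j, IsOpen (N j) := fun j => isOpen_lt (by fun_prop) continuous_const
  have hround : ∀ j, ∀ x ∈ N j, ⌊G x + 1 / 2⌋₊ = j := fun j x hx => by
    obtain ⟨h1, h2⟩ := abs_lt.1 (show |G x - j| < 1 / 2 from hx)
    exact (Nat.floor_eq_iff (by linarith [j.cast_nonneg (α := ℝ)])).2 ⟨by linarith, by linarith⟩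
  have hSN : ∀ x ∈ S, x ∈ N (f x) := fun x hx => by simp [N, hGf x hx]
  refine ⟨⋃ j ∈ f '' S, N j, fun x => ⌊G x + 1 / 2⌋₊, isOpen_biUnion fun j _ => hN j,
    fun x hx => mem_biUnion (mem_image_of_mem f hx) (hSN x hx), fun x hx => ?_, fun x hx => ?_,
    fun x hx => hround _ x (hSN x hx)⟩
  all_goals obtain ⟨j, hj, hxj⟩ := mem_iUnion₂.1 hx
  · exact (continuousAt_const.congr (eventually_of_mem ((hN j).mem_nhds hxj)
      fun y hy => (hround j y hy).symm)).continuousWithinAt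
  · simpa only [hround j x hxj] using hj

end ClopenPieces

section Escape

variable {X : Type*} [TopologicalSpace X] {U Q O : Set X} {ψ : X → ℝ} {w : ℝ}

theorem eventually_levelSet_inter_subset (hψ : ContinuousOn ψ U) (hQ : IsCompact Q) (hQU : Q ⊆ U)
    (hO : IsOpen O) (hw : levelSet U ψ w ∩ Q ⊆ O) : ∀ᶠ v in 𝓝 w, levelSet U ψ v ∩ Q ⊆ O := by
  have himage : IsClosed (ψ '' (Q \ O)) :=
    ((hQ.diff hO).image_of_continuousOn (hψ.mono (sdiff_subset.trans hQU))).isClosed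
  have hwB : w ∉ ψ '' (Q \ O) := by
    rintro ⟨x, hx, hxw⟩
    exact hx.2 (hw ⟨⟨hQU hx.1, hxw⟩, hx.1⟩)
  filter_upwards [himage.isOpen_compl.mem_nhds hwB] with v hv x hx
  exact by_contra fun hxO => hv ⟨x, ⟨hx.2, hxO⟩, hx.1.2⟩

theorem eventually_image_levelSet_subset {Y : Type*} [TopologicalSpace Y] [DiscreteTopology Y]
    {F : X → Y} (hO : IsOpen O) (hOU : O ⊆ U) (hw : levelSet U ψ w ⊆ O) (hF : ContinuousOn F O)
    (hfin : (F '' levelSet U ψ w).Finite) (hopen : ∀ p ∈ levelSet U ψ w, map ψ (𝓝 p) = 𝓝 (ψ p)) :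
    ∀ᶠ v in 𝓝 w, F '' levelSet U ψ w ⊆ F '' (levelSet U ψ v ∩ O) := by
  refine (Filter.eventually_all_finite hfin).2 ?_
  rintro _ ⟨p, hp, rfl⟩
  have hnhds : O ∩ F ⁻¹' {F p} ∈ 𝓝 p :=
    (hF.isOpen_inter_preimage hO (isOpen_discrete {F p})).mem_nhds ⟨hw hp, rfl⟩
  have himage := image_mem_map (m := ψ) hnhds
  rw [hopen p hp, hp.2] at himage
  filter_upwards [himage]
  rintro _ ⟨x, hx, rfl⟩
  exact ⟨x, ⟨⟨hOU hx.1, rfl⟩, hx.1⟩, hx.2⟩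

theorem eventually_levelSet_subset_or_hasClopenPieces_succ [T4Space X] {m : ℕ}
    (hψ : ContinuousOn ψ U) (hQ : IsCompact Q) (hQU : Q ⊆ U) (hw : levelSet U ψ w ⊆ interior Q)
    (hwc : IsCompact (levelSet U ψ w)) (hopen : ∀ p ∈ levelSet U ψ w, map ψ (𝓝 p) = 𝓝 (ψ p))
    (hm : HasClopenPieces (levelSet U ψ w) m) :
    ∀ᶠ v in 𝓝 w, levelSet U ψ v ⊆ Q ∨ HasClopenPieces (levelSet U ψ v) (m + 1) := by
  obtain ⟨f, hf, hfm⟩ := hm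
  obtain ⟨O, F, hO, hwO, hF, hFO, hFf⟩ := exists_isOpen_continuousOn_eqOn hwc.isClosed hf
  rw [hfm] at hFO
  have hFm : F '' levelSet U ψ w = Iio m := hFf.image_eq.trans hfm
  have hO' : IsOpen (O ∩ interior Q) := hO.inter isOpen_interior
  have hO'Q : O ∩ interior Q ⊆ Q := inter_subset_right.trans interior_subset
  have hwO' : levelSet U ψ w ⊆ O ∩ interior Q := subset_inter hwO hw
  have hF' : ContinuousOn F (O ∩ interior Q) := hF.mono inter_subset_left
  filter_upwards [eventually_levelSet_inter_subset hψ hQ hQU hO' (inter_subset_left.trans hwO'),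
    eventually_image_levelSet_subset hO' (hO'Q.trans hQU) hwO' hF' (hFm ▸ finite_Iio m) hopen]
    with v hvO hvF
  exact or_iff_not_imp_left.2 (hasClopenPieces_succ hQ.isClosed hO' hO'Q hvO hF'
    (hFO.mono_left inter_subset_left) (hFm ▸ hvF))

end Escape

section RegularLevel

theorem map_nhds_eq_of_mem_regularSet {E : Type*} [NormedAddCommGroup E] [NormedSpace ℝ E]
    [CompleteSpace E] {U : Set E} {ψ : E → ℝ} (hU : IsOpen U) (hψ : ContDiffOn ℝ 1 ψ U) {p : E}
    (hp : p ∈ regularSet U ψ) : map ψ (𝓝 p) = 𝓝 (ψ p) := by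
  have hs := (hψ.contDiffAt (hU.mem_nhds hp.1)).hasStrictFDerivAt (by simp)
  refine hs.map_nhds_eq_of_surj (LinearMap.range_eq_top.2 (LinearMap.surjective fun h => ?_))
  exact hp.2 (ContinuousLinearMap.coe_injective h)

theorem IsSubmanifoldAt.exists_isPreconnected_mem_nhdsWithin {E H : Type*} [NormedAddCommGroup E]
    [NormedSpace ℝ E] [NormedAddCommGroup H] [NormedSpace ℝ H] {A : Set E} {p : E}
    (hA : IsSubmanifoldAt H A p) : ∃ t ∈ 𝓝[A] p, t ⊆ A ∧ IsPreconnected t := by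
  obtain ⟨g, h, hg, hh, -, hgz, hgx⟩ := hA
  have hcont : ∀ᶠ z in 𝓝 (h p), ContinuousAt g z :=
    ((hg.of_le (WithTop.coe_le_coe.2 le_top) : ContDiffAt ℝ 1 g (h p)).eventually
      (by simp)).mono fun z hz => hz.continuousAt
  obtain ⟨ε, hε, hball⟩ := Metric.eventually_nhds_iff_ball.1 (hcont.and hgz)
  refine ⟨g '' Metric.ball (h p) ε, ?_, image_subset_iff.2 fun z hz => (hball z hz).2.1, ?_⟩
  · filter_upwards [hgx, nhdsWithin_le_nhds
      (hh.continuousAt.preimage_mem_nhds (Metric.ball_mem_nhds (h p) hε))] with x hx hxε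
    exact ⟨h x, hxε, hx⟩
  · exact (convex_ball (h p) ε).isPreconnected.image g
      fun z hz => (hball z hz).1.continuousWithinAt

theorem exists_isCompact_eventually_levelSet_subset {E : Type*} [NormedAddCommGroup E]
    [InnerProductSpace ℝ E] [FiniteDimensional ℝ E] {U : Set E} {ψ : E → ℝ} {w : ℝ}
    (hU : IsOpen U) (hψ : ContDiffOn ℝ ∞ ψ U) (hwc : IsCompact (levelSet U ψ w))
    (hreg : levelSet U ψ w ⊆ regularSet U ψ)
    (hdiff : ∀ᶠ v in 𝓝 w, DiffeomorphicSubsets (levelSet U ψ w) (levelSet U ψ v)) :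
    ∃ Q, IsCompact Q ∧ Q ⊆ regularSet U ψ ∧ ∀ᶠ v in 𝓝 w, levelSet U ψ v ⊆ Q := by
  obtain ⟨Q, hQ, hwQ, hQR⟩ := exists_compact_between hwc (isOpen_regularSet hU hψ) hreg
  refine ⟨Q, hQ, hQR, ?_⟩
  have hbdd : BddAbove {m | HasClopenPieces (levelSet U ψ w) m} := by
    refine bddAbove_setOf_hasClopenPieces hwc ?_
    rintro p ⟨hpU, rfl⟩
    obtain ⟨H, e, hpe, he⟩ := exists_isLevelChart hU hψ (hreg ⟨hpU, rfl⟩)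
    exact (he.isSubmanifoldAt hpe).exists_isPreconnected_mem_nhdsWithin
  have hmax := Nat.sSup_mem (exists_hasClopenPieces (levelSet U ψ w)) hbdd
  filter_upwards [hdiff, eventually_levelSet_subset_or_hasClopenPieces_succ hψ.continuousOn hQ
    (fun x hx => (hQR hx).1) hwQ hwc (fun p hp => map_nhds_eq_of_mem_regularSet hU
      (hψ.of_le (WithTop.coe_le_coe.2 le_top)) (hreg hp)) hmax] with v hv hor
  refine hor.resolve_right fun hpieces => ?_
  obtain ⟨f, h, hf, -, hfm, hhm, -, hright⟩ := hv
  have hle := le_csSup hbdd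
    (hpieces.of_image_eq hf.continuousOn ((hright.surjOn hhm).image_eq_of_mapsTo hfm))
  exact (Nat.lt_succ_self _).not_ge hle

end RegularLevel

section LevelIntegral

variable {κ : Type*} [Fintype κ] {U : Set (EuclideanSpace ℝ κ)} {ψ g : EuclideanSpace ℝ κ → ℝ}
  {v₀ v₁ : ℝ}

theorem surfaceMeasure_eq_euclideanHausdorffMeasure_finrank (κ : Type*) [Fintype κ] :
    surfaceMeasure κ = μHE[finrank ℝ (EuclideanSpace ℝ κ) - 1] := by
  rw [finrank_euclideanSpace, surfaceMeasure]

theorem smoothLevelIntegral_of_eventually_subset (hU : IsOpen U) (hψ : ContDiffOn ℝ ∞ ψ U)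
    (hg : ContDiffOn ℝ ∞ g (regularSet U ψ))
    (hQ : ∀ w ∈ Ioo v₀ v₁, ∃ Q, IsCompact Q ∧ Q ⊆ regularSet U ψ ∧
      ∀ᶠ v in 𝓝 w, levelSet U ψ v ⊆ Q) :
    SmoothLevelIntegral U ψ g v₀ v₁ := by
  rw [SmoothLevelIntegral, surfaceMeasure_eq_euclideanHausdorffMeasure_finrank]
  refine forall₂_and.1 fun w hw => ?_
  obtain ⟨Q, hQ, hQR, hev⟩ := hQ w hw
  exact (contDiffAt_setIntegral_levelSet hU hψ hg hQ hQR hev).imp_right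
    ContDiffAt.contDiffWithinAt

theorem smoothLevelIntegral_of_morseOn (hκ : 2 ≤ Fintype.card κ) (hU : IsOpen U)
    (hψ : ContDiffOn ℝ ∞ ψ U) (hM : MorseOn ψ {x ∈ U | ψ x ∈ Ioo v₀ v₁})
    (hc : ∀ v ∈ Ioo v₀ v₁, IsCompact (levelSet U ψ v))
    (hdiff : ∀ v ∈ Ioo v₀ v₁, ∀ v' ∈ Ioo v₀ v₁,
      DiffeomorphicSubsets (levelSet U ψ v) (levelSet U ψ v'))
    (hg : ContDiffOn ℝ ∞ g (regularSet U ψ)) : SmoothLevelIntegral U ψ g v₀ v₁ := by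
  refine smoothLevelIntegral_of_eventually_subset hU hψ hg fun w hw => ?_
  refine exists_isCompact_eventually_levelSet_subset hU hψ (hc w hw)
    (hM.levelSet_subset_regularSet (by rwa [finrank_euclideanSpace]) hU hψ hdiff hw) ?_
  filter_upwards [isOpen_Ioo.mem_nhds hw] with v hv using hdiff w hw v hv

theorem fderiv_ne_zero_iff_gradient_ne_zero {x : EuclideanSpace ℝ κ} :
    fderiv ℝ ψ x ≠ 0 ↔ gradient ψ x ≠ 0 := by
  simp [gradient]

theorem smoothLevelIntegral_of_gradient_ne_zero (hU : IsOpen U) (hψ : ContDiffOn ℝ ∞ ψ U)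
    (hc : ∀ a b, v₀ < a → b < v₁ → IsCompact {x ∈ U | a ≤ ψ x ∧ ψ x ≤ b})
    (hgrad : ∀ x ∈ U, ψ x ∈ Ioo v₀ v₁ → gradient ψ x ≠ 0)
    (hg : ContDiffOn ℝ ∞ g (regularSet U ψ)) : SmoothLevelIntegral U ψ g v₀ v₁ := by
  refine smoothLevelIntegral_of_eventually_subset hU hψ hg fun w hw => ?_
  obtain ⟨a, ha, haw⟩ := exists_between hw.1
  obtain ⟨b, hwb, hb⟩ := exists_between hw.2
  refine ⟨_, hc a b ha hb, fun x hx => ⟨hx.1, fderiv_ne_zero_iff_gradient_ne_zero.2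
    (hgrad x hx.1 ⟨ha.trans_le hx.2.1, hx.2.2.trans_lt hb⟩)⟩, ?_⟩
  filter_upwards [Icc_mem_nhds haw hwb]
  rintro _ hv x ⟨hx, rfl⟩
  exact ⟨hx, hv⟩

theorem contDiffOn_one_div_norm_gradient (hU : IsOpen U) (hψ : ContDiffOn ℝ ∞ ψ U) :
    ContDiffOn ℝ ∞ (fun x => 1 / ‖gradient ψ x‖) (regularSet U ψ) := by
  have hgrad : ContDiffOn ℝ ∞ (gradient ψ) (regularSet U ψ) :=
    (InnerProductSpace.toDual ℝ (EuclideanSpace ℝ κ)).symm.contDiff.comp_contDiffOn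
      ((hψ.fderiv_of_isOpen hU (by simp)).mono fun x hx => hx.1)
  have hne : ∀ x ∈ regularSet U ψ, gradient ψ x ≠ 0 := fun x hx =>
    fderiv_ne_zero_iff_gradient_ne_zero.1 hx.2
  exact contDiffOn_const.div (hgrad.norm ℝ hne) fun x hx => norm_ne_zero_iff.2 (hne x hx)

end LevelIntegral

section Potential

variable {κ : Type*} [Fintype κ] {V : EuclideanSpace ℝ κ → EReal} {v₀ v₁ : ℝ}

theorem equipotential_eq_levelSet {E : Type*} {V : E → EReal} (hV : ∀ q, V q ≠ ⊥) (v : ℝ) :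
    equipotential V v = levelSet {q | V q ≠ ⊤} (fun q => (V q).toReal) v := by
  ext q
  refine ⟨fun hq : V q = v => ⟨by simp [hq], by simp [hq]⟩, ?_⟩
  rintro ⟨hq, rfl⟩
  exact (EReal.coe_toReal hq (hV q)).symm

theorem smoothStructureIntegral_of_morseOn (hκ : 2 ≤ Fintype.card κ) (hV : IsSmoothPotential V)
    (hb : ∀ v ∈ Ioo v₀ v₁, Bornology.IsBounded (equipotential V v))
    (hM : MorseOn (fun q => (V q).toReal) {q | (v₀ : EReal) < V q ∧ V q < (v₁ : EReal)})
    (hdiff : ∀ v ∈ Ioo v₀ v₁, ∀ v' ∈ Ioo v₀ v₁,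
      DiffeomorphicSubsets (equipotential V v) (equipotential V v')) :
    SmoothStructureIntegral V v₀ v₁ := by
  have hU : IsOpen {q | V q ≠ ⊤} := isOpen_ne.preimage hV.continuous
  have hlevel := equipotential_eq_levelSet hV.ne_bot
  have hc : ∀ v ∈ Ioo v₀ v₁, IsCompact (equipotential V v) := fun v hv =>
    Metric.isCompact_of_isClosed_isBounded (isClosed_singleton.preimage hV.continuous) (hb v hv)
  have hM' : MorseOn (fun q => (V q).toReal) {q ∈ {q | V q ≠ ⊤} | (V q).toReal ∈ Ioo v₀ v₁} := by
    rintro q ⟨hq, hv⟩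
    have hcoe := EReal.coe_toReal hq (hV.ne_bot q)
    exact hM q ⟨hcoe ▸ EReal.coe_lt_coe hv.1, hcoe ▸ EReal.coe_lt_coe hv.2⟩
  simp only [hlevel] at hc hdiff
  unfold SmoothStructureIntegral structureIntegral
  simp only [hlevel]
  exact smoothLevelIntegral_of_morseOn hκ hU hV.contDiffOn hM' hc hdiff
    (contDiffOn_one_div_norm_gradient hU hV.contDiffOn)

end Potential

section Confinement

theorem isBounded_setOf_forall_position_mem {ι : Type*} [Finite ι] {D : ℕ}
    {K : Set (EuclideanSpace ℝ (Fin D))} (hK : Bornology.IsBounded K) :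
    Bornology.IsBounded {q : EuclideanSpace ℝ (ι × Fin D) | ∀ i, position q i ∈ K} := by
  cases nonempty_fintype ι
  obtain ⟨R, hR⟩ := hK.exists_norm_le
  refine isBounded_iff_forall_norm_le.2 ⟨√(∑ _p : ι × Fin D, R ^ 2), fun q hq => ?_⟩
  rw [EuclideanSpace.norm_eq]
  gcongr with p
  exact (PiLp.norm_apply_le (position q p.1) p.2).trans (hR _ (hq p.1))

theorem ConfinesSites.isBounded_equipotential {ι : Type*} [Finite ι] {D : ℕ}
    {V : EuclideanSpace ℝ (ι × Fin D) → EReal} (hV : ConfinesSites V) (v : ℝ) :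
    Bornology.IsBounded (equipotential V v) := by
  obtain ⟨K, hK, hVK⟩ := hV v
  exact (isBounded_setOf_forall_position_mem hK.isBounded).subset fun q hq => hVK q (le_of_eq hq)

theorem ereal_sum_eq_top {α : Type*} {s : Finset α} {f : α → EReal} (hf : ∀ i ∈ s, f i ≠ ⊥)
    {i : α} (hi : i ∈ s) (hfi : f i = ⊤) : ∑ i ∈ s, f i = ⊤ := by
  classical
  rw [← Finset.add_sum_erase s f hi, hfi]
  refine EReal.top_add_of_ne_bot fun h => ?_
  obtain ⟨j, hj, hfj⟩ := WithBot.sum_eq_bot_iff.1 h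
  exact hf j (Finset.mem_of_mem_erase hj) hfj

variable {n d : ℕ} {Ψ : ℝ → EReal} {Λ Λ' : Set (EuclideanSpace ℝ (Fin d))}
  {U : EuclideanSpace ℝ (Fin d) → EReal}

theorem IsSmoothBarrier.position_mem_of_fluidPotential_ne_top (hU : IsSmoothBarrier Λ Λ' U)
    {q : EuclideanSpace ℝ (Fin n × Fin d)} (hbot : fluidPotential n d Ψ U q ≠ ⊥)
    (htop : fluidPotential n d Ψ U q ≠ ⊤) (i : Fin n) : position q i ∈ Λ := by
  by_contra hi
  have hsum : ∑ j, U (position q j) = ⊤ :=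
    ereal_sum_eq_top (fun j _ => hU.smooth.ne_bot _) (Finset.mem_univ i) (hU.eq_top _ hi)
  rw [fluidPotential, hsum] at hbot htop
  exact htop (EReal.add_top_of_ne_bot fun h => hbot (by rw [h, EReal.bot_add]))

theorem IsSmoothBarrier.isBounded_equipotential_fluidPotential (hU : IsSmoothBarrier Λ Λ' U)
    (v : ℝ) : Bornology.IsBounded (equipotential (fluidPotential n d Ψ U) v) :=
  (isBounded_setOf_forall_position_mem hU.isCompact.isBounded).subset
    fun _q (hq : fluidPotential n d Ψ U _ = v) => hU.position_mem_of_fluidPotential_ne_top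
      (hq ▸ EReal.coe_ne_bot v) (hq ▸ EReal.coe_ne_top v)

end Confinement

end StructureIntegral

theorem lemma2_general {κ : Type*} [Fintype κ] (v₀ v₁ : ℝ) :
    (∀ V : EuclideanSpace ℝ κ → EReal, 2 ≤ Fintype.card κ →
      StructureIntegral.IsSmoothPotential V →
      (∀ v ∈ Ioo v₀ v₁, Bornology.IsBounded (StructureIntegral.equipotential V v)) →
      StructureIntegral.MorseOn (fun q => (V q).toReal)
        {q | (v₀ : EReal) < V q ∧ V q < (v₁ : EReal)} →
      (∀ v ∈ Ioo v₀ v₁, ∀ v' ∈ Ioo v₀ v₁, StructureIntegral.DiffeomorphicSubsets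
        (StructureIntegral.equipotential V v) (StructureIntegral.equipotential V v')) →
      StructureIntegral.SmoothStructureIntegral V v₀ v₁) ∧
    (∀ (U : Set (EuclideanSpace ℝ κ)) (ψ g : EuclideanSpace ℝ κ → ℝ), 2 ≤ Fintype.card κ →
      IsOpen U → ContDiffOn ℝ ∞ ψ U →
      StructureIntegral.MorseOn ψ {x ∈ U | ψ x ∈ Ioo v₀ v₁} →
      (∀ v ∈ Ioo v₀ v₁, IsCompact (StructureIntegral.levelSet U ψ v)) →
      (∀ v ∈ Ioo v₀ v₁, ∀ v' ∈ Ioo v₀ v₁, StructureIntegral.DiffeomorphicSubsets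
        (StructureIntegral.levelSet U ψ v) (StructureIntegral.levelSet U ψ v')) →
      ContDiffOn ℝ ∞ g (StructureIntegral.regularSet U ψ) →
      StructureIntegral.SmoothLevelIntegral U ψ g v₀ v₁) ∧
    (∀ (U : Set (EuclideanSpace ℝ κ)) (ψ g : EuclideanSpace ℝ κ → ℝ),
      IsOpen U → ContDiffOn ℝ ∞ ψ U →
      (∀ a b, v₀ < a → b < v₁ → IsCompact {x ∈ U | a ≤ ψ x ∧ ψ x ≤ b}) →
      (∀ x ∈ U, ψ x ∈ Ioo v₀ v₁ → gradient ψ x ≠ 0) →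
      ContDiffOn ℝ ∞ g (StructureIntegral.regularSet U ψ) →
      StructureIntegral.SmoothLevelIntegral U ψ g v₀ v₁) :=
  ⟨fun _ => StructureIntegral.smoothStructureIntegral_of_morseOn,
    fun _ _ _ => StructureIntegral.smoothLevelIntegral_of_morseOn,
    fun _ _ _ => StructureIntegral.smoothLevelIntegral_of_gradient_ne_zero⟩

theorem lemma2 :
    -- fluid case
    (∀ (n d : ℕ) (Ψ : ℝ → EReal) (Λ Λ' : Set (EuclideanSpace ℝ (Fin d)))
      (U : EuclideanSpace ℝ (Fin d) → EReal) (v₀ v₁ : ℝ),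
      2 ≤ n * d →
      StructureIntegral.IsSmoothBarrier Λ Λ' U →
      StructureIntegral.IsSmoothPotential (StructureIntegral.fluidPotential n d Ψ U) →
      StructureIntegral.MorseOn
        (fun q => (StructureIntegral.fluidPotential n d Ψ U q).toReal)
        {q | (v₀ : EReal) ≤ StructureIntegral.fluidPotential n d Ψ U q ∧
          StructureIntegral.fluidPotential n d Ψ U q ≤ (v₁ : EReal)} →
      (∀ v ∈ Set.Icc v₀ v₁, ∀ v' ∈ Set.Icc v₀ v₁,
        StructureIntegral.DiffeomorphicSubsets
          (StructureIntegral.equipotential (StructureIntegral.fluidPotential n d Ψ U) v)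
          (StructureIntegral.equipotential (StructureIntegral.fluidPotential n d Ψ U) v')) →
      StructureIntegral.SmoothStructureIntegral
        (StructureIntegral.fluidPotential n d Ψ U) v₀ v₁) ∧
    -- lattice case
    (∀ (d : ℕ) (I : Finset (Fin d → ℕ)) (D : ℕ) (C : (Fin d → ℕ) → (Fin d → ℕ) → ℝ)
      (Ψ : ℝ → EReal) (Φ : EuclideanSpace ℝ (Fin D) → EReal) (v₀ v₁ : ℝ),
      2 ≤ I.card * D →
      StructureIntegral.IsSmoothPotential (StructureIntegral.latticePotential I D C Ψ Φ) →
      StructureIntegral.ConfinesSites (StructureIntegral.latticePotential I D C Ψ Φ) →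
      StructureIntegral.MorseOn
        (fun q => (StructureIntegral.latticePotential I D C Ψ Φ q).toReal)
        {q | (v₀ : EReal) ≤ StructureIntegral.latticePotential I D C Ψ Φ q ∧
          StructureIntegral.latticePotential I D C Ψ Φ q ≤ (v₁ : EReal)} →
      (∀ v ∈ Set.Icc v₀ v₁, ∀ v' ∈ Set.Icc v₀ v₁,
        StructureIntegral.DiffeomorphicSubsets
          (StructureIntegral.equipotential (StructureIntegral.latticePotential I D C Ψ Φ) v)
          (StructureIntegral.equipotential (StructureIntegral.latticePotential I D C Ψ Φ) v')) →
      StructureIntegral.SmoothStructureIntegral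
        (StructureIntegral.latticePotential I D C Ψ Φ) v₀ v₁) ∧
    -- Morse functions on bounded open sets, smooth integrands
    (∀ (N : ℕ) (U : Set (EuclideanSpace ℝ (Fin N))) (ψ : EuclideanSpace ℝ (Fin N) → ℝ)
      (v₀ v₁ : ℝ),
      2 ≤ N → IsOpen U → Bornology.IsBounded U → ContDiffOn ℝ ∞ ψ U →
      StructureIntegral.MorseOn ψ {x ∈ U | v₀ ≤ ψ x ∧ ψ x ≤ v₁} →
      (∀ v ∈ Set.Icc v₀ v₁, IsCompact (StructureIntegral.levelSet U ψ v)) →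
      (∀ v ∈ Set.Icc v₀ v₁, ∀ v' ∈ Set.Icc v₀ v₁,
        StructureIntegral.DiffeomorphicSubsets
          (StructureIntegral.levelSet U ψ v) (StructureIntegral.levelSet U ψ v')) →
      ∀ g : EuclideanSpace ℝ (Fin N) → ℝ, ContDiffOn ℝ ∞ g U →
        StructureIntegral.SmoothLevelIntegral U ψ g v₀ v₁) ∧
    -- gradient bounded below on the region between the levels, smooth integrands
    (∀ (N : ℕ) (U : Set (EuclideanSpace ℝ (Fin N))) (ψ : EuclideanSpace ℝ (Fin N) → ℝ)
      (v₀ v₁ c : ℝ),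
      1 ≤ N → IsOpen U → Bornology.IsBounded U → ContDiffOn ℝ ∞ ψ U →
      (∀ a b : ℝ, v₀ < a → b < v₁ → IsCompact {x ∈ U | a ≤ ψ x ∧ ψ x ≤ b}) →
      0 < c → (∀ x ∈ U, v₀ < ψ x → ψ x < v₁ → c ≤ ‖gradient ψ x‖) →
      ∀ g : EuclideanSpace ℝ (Fin N) → ℝ, ContDiffOn ℝ ∞ g U →
        StructureIntegral.SmoothLevelIntegral U ψ g v₀ v₁) := by
  refine ⟨?_, ?_, ?_, ?_⟩
  · intro n d Ψ Λ Λ' U v₀ v₁ hN hU hV hM hdiff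
    exact (lemma2_general v₀ v₁).1 _ (by simpa using hN) hV
      (fun v _ => hU.isBounded_equipotential_fluidPotential v)
      (hM.mono fun _ hq => hq.imp le_of_lt le_of_lt)
      fun v hv v' hv' => hdiff v (Ioo_subset_Icc_self hv) v' (Ioo_subset_Icc_self hv')
  · intro d I D C Ψ Φ v₀ v₁ hN hV hconf hM hdiff
    exact (lemma2_general v₀ v₁).1 _ (by simpa using hN) hV
      (fun v _ => hconf.isBounded_equipotential v)
      (hM.mono fun _ hq => hq.imp le_of_lt le_of_lt)
      fun v hv v' hv' => hdiff v (Ioo_subset_Icc_self hv) v' (Ioo_subset_Icc_self hv')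
  · intro N U ψ v₀ v₁ hN hU _ hψ hM hc hdiff g hg
    exact (lemma2_general v₀ v₁).2.1 U ψ g (by simpa using hN) hU hψ
      (hM.mono fun _ hx => ⟨hx.1, Ioo_subset_Icc_self hx.2⟩)
      (fun v hv => hc v (Ioo_subset_Icc_self hv))
      (fun v hv v' hv' => hdiff v (Ioo_subset_Icc_self hv) v' (Ioo_subset_Icc_self hv'))
      (hg.mono (sep_subset U _))
  · intro N U ψ v₀ v₁ c _ hU _ hψ hc hc0 hgrad g hg
    exact (lemma2_general v₀ v₁).2.2 U ψ g hU hψ hc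
      (fun x hx hv => norm_pos_iff.1 (hc0.trans_le (hgrad x hx hv.1 hv.2)))
      (hg.mono (sep_subset U _))
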